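/- Let $M$ be a complex manifold of dimension $m$ with a Kähler metric $g_M$, and let $\pi:(L,h)\to M$ be a holomorphic line bundle with a smooth Hermitian metric such that the Kähler form is $\omega_M=-\sqrt{-1}\,\partial\bar\partial\log h$ (where $h=|s|_h^2$ for a local holomorphic frame $s$, and a metric $\sum g_{j\bar k}\,dz_j\,d\bar z_k$ has the form $\sqrt{-1}\sum g_{j\bar k}\,dz_j\wedge d\bar z_k$). Let $(L^*,h^{-1})$ be the dual bundle, with projection again denoted $\pi:L^*\to M$, and let $D(L^*)=\{\eta\in L^*:|\eta|_{h^{-1}}<1\}$. Then $$\omega_D=\pi^*\omega_M-\sqrt{-1}\,\partial\bar\partial\log\bigl(1-|\eta|^2_{h^{-1}}\bigr)$$ is the Kähler form of a Kähler metric $g_D$ on $D(L^*)$, and the following holds. For every $\eta_0\in D(L^*)$, with $z_0=\pi(\eta_0)$, there are holomorphic coordinates $z=(z_1,\dots,z_m)$ of $M$ around $z_0$ and a holomorphic frame $s$ of $L$ on their domain such that $(z,v)$, with $v(\eta)=\eta(s)$, are holomorphic coordinates of $L^*$ around $\eta_0$ and * at $z_0$ one has $g_{j\bar k}=\delta_{jk}$,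 all first derivatives of the coefficients $g_{j\bar k}$ of $g_M$ vanish, and $|s(z_0)|_h=1$, so that $|v|^2:=|v(\eta_0)|^2=|\eta_0|^2_{h^{-1}}$; * $\displaystyle g_D(\eta_0)=\frac{1}{1-|v|^2}\Bigl(\frac{dv\,\overline{dv}}{1-|v|^2}+\sum_j dz_j\,\overline{dz_j}\Bigr)$; * for every nonzero $U\in T^{1,0}_{\eta_0}D(L^*)$, with $X=d\pi(U)$, the holomorphic sectional curvature $\Theta_D$ of $g_D$ is $$\Theta_D(\eta_0,U)=\frac{-2\Bigl(g_D(U,\bar U)^2-\dfrac{g_M(X,\bar X)^2}{1-|v|^2}\bigl(1+\tfrac12\Theta_M(z_0,X)\bigr)\Bigr)}{g_D(U,\bar U)^2}.$$ Here the holomorphic sectional curvature of a Kähler metric $g$ is $\Theta(p,U)=R(U,\bar U,U,\bar U)/g(U,\bar U)^2$ with $R_{i\bar jk\bar l}=-\partial_k\partial_{\bar l}g_{i\bar j}+g^{\bar q p}\,\partial_kg_{i\bar q}\,\partial_{\bar l}g_{p\bar j}$; for $X=0$ the term containing $g_M(X,\bar X)^2\,\Theta_M(z_0,X)$ is read as $0$.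 -/

import Mathlib

open Bundle
open scoped Manifold ContDiff

/-! ### Wirtinger calculus on a complex normed space -/

section Wirtinger

variable {E : Type*} [NormedAddCommGroup E] [NormedSpace ℂ E]

/-- The `(1,0)`-derivative `∂_u F = ∑ u_j ∂F/∂z_j` of a real-differentiable `F` at `x`. -/
noncomputable def wirtinger (F : E → ℂ) (x u : E) : ℂ :=
  (fderiv ℝ F x u - Complex.I * fderiv ℝ F x (Complex.I • u)) / 2

/-- The `(0,1)`-derivative `∂_{ū} F = ∑ ū_j ∂F/∂z̄_j` of a real-differentiable `F` at `x`. -/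
noncomputable def wirtingerBar (F : E → ℂ) (x u : E) : ℂ :=
  (fderiv ℝ F x u + Complex.I * fderiv ℝ F x (Complex.I • u)) / 2

/-- `∑ (∂²F/∂z_j∂z̄_k) u_j v̄_k` at `x`. -/
noncomputable def ddbar (F : E → ℂ) (x u v : E) : ℂ :=
  wirtinger (fun y => wirtingerBar F y v) x u

end Wirtinger

/-- `g` is a Hermitian inner product, linear in the first and conjugate linear in the second
variable. -/
structure IsHermitianInner {V : Type*} [AddCommGroup V] [Module ℂ V] (g : V → V → ℂ) : Prop where
  add_left : ∀ u v w, g (u + v) w = g u w + g v w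
  smul_left : ∀ (c : ℂ) (u w), g (c • u) w = c * g u w
  conj_symm : ∀ u w, g w u = (starRingEnd ℂ) (g u w)
  pos : ∀ u, u ≠ 0 → 0 < (g u u).re

/-! ### Curvature of a Hermitian metric in coordinates -/

section Coordinates

variable {E : Type*} [NormedAddCommGroup E] [NormedSpace ℂ E] [FiniteDimensional ℂ E]

/-- The matrix `T = (g_{jk̄})` of a sesquilinear form in a basis of the coordinate space. -/
noncomputable def metricMatrix (g : E → E → ℂ) :
    Matrix (Fin (Module.finrank ℂ E)) (Fin (Module.finrank ℂ E)) ℂ :=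
  fun j k => g (Module.finBasis ℂ E j) (Module.finBasis ℂ E k)

/-- The curvature `R(U, Ū, U, Ū)` at `x`, where `G` gives the metric coefficients in coordinates:
with `U = ∑ u_j ∂/∂z_j` it is `u (-∂∂̄ T + ∂T · T⁻¹ · (∂T)^*) u^*`, that is
`-∑ (∂²g_{jk̄}/∂z_p∂z̄_q) u_j ū_k u_p ū_q + ∑ g^{b̄a} (∂g_{jā}/∂z_p)(∂g_{bk̄}/∂z̄_q) u_j ū_k u_p ū_q`. -/
noncomputable def curvatureQuartic (G : E → E → E → ℂ) (x u : E) : ℂ :=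
  let r : Fin (Module.finrank ℂ E) → ℂ :=
    fun k => wirtinger (fun y => G y u (Module.finBasis ℂ E k)) x u
  dotProduct (Matrix.vecMul r (metricMatrix (G x))⁻¹) (star r) - ddbar (fun y => G y u u) x u u

/-- The holomorphic sectional curvature `R(U, Ū, U, Ū) / g(U, Ū)²` in coordinates. -/
noncomputable def holSectCurvCoord (G : E → E → E → ℂ) (x u : E) : ℝ :=
  (curvatureQuartic G x u).re / (G x u u).re ^ 2

end Coordinates

/-! ### Hermitian and Kähler metrics on a complex manifold -/

section Manifold

variable {E : Type*} [NormedAddCommGroup E] [NormedSpace ℂ E]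
  {H : Type*} [TopologicalSpace H] (I : ModelWithCorners ℂ E H)
  {N : Type*} [TopologicalSpace N] [ChartedSpace H N]

/-- A field of `ℂ`-valued forms `g(U, V̄)` on the (holomorphic) tangent spaces. -/
abbrev FormField (I : ModelWithCorners ℂ E H) (N : Type*) [TopologicalSpace N]
    [ChartedSpace H N] : Type _ :=
  ∀ p : N, TangentSpace I p → TangentSpace I p → ℂ

/-- The coefficients of `g` in the coordinates whose inverse (parametrization) is `ψ`. -/
noncomputable def coeffs {E' : Type*} [NormedAddCommGroup E'] [NormedSpace ℂ E']
    (g : FormField I N) (ψ : E' → N) (y a b : E') : ℂ :=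
  g (ψ y) (mfderiv 𝓘(ℂ, E') I ψ y a) (mfderiv 𝓘(ℂ, E') I ψ y b)

/-- `Φ` is a holomorphic coordinate system (on its source) with values in `E'`. -/
structure IsHolomorphicChart {E' : Type*} [NormedAddCommGroup E'] [NormedSpace ℂ E']
    (Φ : OpenPartialHomeomorph N E') : Prop where
  holo : ContMDiffOn I 𝓘(ℂ, E') ω Φ Φ.source
  holo_symm : ContMDiffOn 𝓘(ℂ, E') I ω Φ.symm Φ.target

/-- The real-valued function `f` is smooth (in the real sense) at `p`. -/
def RealSmoothAt (f : N → ℝ) (p : N) : Prop :=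
  ContDiffAt ℝ ∞ (f ∘ (extChartAt I p).symm) (extChartAt I p p)

/-- `g` is a Kähler metric on the open set `S`: it is Hermitian, positive definite and smooth, and
its fundamental form is closed (`∂g_{jk̄}/∂z_l = ∂g_{lk̄}/∂z_j`). -/
structure IsKahlerOn (g : FormField I N) (S : Set N) : Prop where
  hermitian : ∀ p ∈ S, IsHermitianInner (V := TangentSpace I p) (g p)
  smooth : ∀ p ∈ S, ∀ a b : E,
    ContDiffAt ℝ ∞ (fun y => coeffs I g (extChartAt I p).symm y a b) (extChartAt I p p)
  closed : ∀ p ∈ S, ∀ a b c : E,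
    wirtinger (fun y => coeffs I g (extChartAt I p).symm y a b) (extChartAt I p p) c =
      wirtinger (fun y => coeffs I g (extChartAt I p).symm y c b) (extChartAt I p p) a

/-- The coefficients `∑ (∂²f/∂z_j∂z̄_k) u_j v̄_k` of `∂∂̄ f` at `p`. -/
noncomputable def leviForm (f : N → ℝ) : FormField I N := fun p U V =>
  ddbar (fun y : E => ((f ((extChartAt I p).symm y) : ℝ) : ℂ)) (extChartAt I p p) U V

/-- The holomorphic sectional curvature `Θ(p, U)` of `g`. -/
noncomputable def holSectCurv [FiniteDimensional ℂ E] (g : FormField I N) (p : N)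
    (U : TangentSpace I p) : ℝ :=
  holSectCurvCoord (coeffs I g (extChartAt I p).symm) (extChartAt I p p) U

/-- In the holomorphic coordinates `e` around `p` the metric `g` satisfies `g_{jk̄} = δ_{jk}`
and has vanishing first derivatives at `p` (geodesic coordinates). -/
structure IsGeodesicAt {m : ℕ} (g : FormField I N)
    (e : OpenPartialHomeomorph N (EuclideanSpace ℂ (Fin m))) (p : N) : Prop where
  chart : IsHolomorphicChart I e
  mem : p ∈ e.source
  unit : ∀ a b : EuclideanSpace ℂ (Fin m),
    coeffs I g e.symm (e p) a b = ∑ j, a j * (starRingEnd ℂ) (b j)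
  deriv_zero : ∀ a b c : EuclideanSpace ℂ (Fin m),
    wirtinger (fun y => coeffs I g e.symm y a b) (e p) c = 0 ∧
      wirtingerBar (fun y => coeffs I g e.symm y a b) (e p) c = 0

end Manifold

/-! ### Hermitian holomorphic line bundles and the disc bundle of the dual -/

section LineBundle

variable {E : Type*} [NormedAddCommGroup E] [NormedSpace ℂ E]
  {H : Type*} [TopologicalSpace H] (I : ModelWithCorners ℂ E H)
  {M : Type*} [TopologicalSpace M] [ChartedSpace H M]
  (L : M → Type*) [∀ x, AddCommGroup (L x)] [∀ x, Module ℂ (L x)] [∀ x, TopologicalSpace (L x)]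
  [TopologicalSpace (TotalSpace ℂ L)] [FiberBundle ℂ L] [VectorBundle ℂ ℂ L]

/-- The local holomorphic frame of `L` around `p` given by the preferred trivialization there. -/
noncomputable def localFrame (p x : M) : L x := (trivializationAt ℂ L p).symm x 1

/-- A smooth Hermitian metric on the line bundle `L`. -/
structure HermitianLineMetric where
  /-- the inner product `h(s, t̄)` on each fibre -/
  form : ∀ x, L x → L x → ℂ
  hermitian : ∀ x, IsHermitianInner (form x)
  smooth : ∀ p, RealSmoothAt I (fun x => (form x (localFrame L p x) (localFrame L p x)).re) p

/-- The total space of the dual line bundle `L*`. -/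
abbrev DualTotal : Type _ :=
  TotalSpace (ℂ →L[ℂ] ℂ) (fun x => L x →L[ℂ] Bundle.Trivial M ℂ x)

/-- The model with corners of the complex manifold `L*`. -/
noncomputable abbrev dualModel : ModelWithCorners ℂ (E × (ℂ →L[ℂ] ℂ)) (ModelProd H (ℂ →L[ℂ] ℂ)) :=
  I.prod 𝓘(ℂ, ℂ →L[ℂ] ℂ)

variable {I L}

/-- `|s|²_h = h(s, s̄)`. -/
def HermitianLineMetric.normSq (h : HermitianLineMetric I L) {x : M} (s : L x) : ℝ :=
  (h.form x s s).re

/-- The coefficients of `-∂∂̄ log h`, computed as `-∂∂̄ log |s|²_h` in a local holomorphic frame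
`s` of `L`. -/
noncomputable def HermitianLineMetric.curvatureForm (h : HermitianLineMetric I L) :
    FormField I M := fun p U V =>
  -leviForm I (fun x => Real.log (h.normSq (localFrame L p x))) p U V

/-- `|η|²_{h⁻¹} = |η(s)|² / |s|²_h`, with `s ≠ 0` in the fibre of `L` under `η`. -/
noncomputable def HermitianLineMetric.dualNormSq (h : HermitianLineMetric I L)
    (η : DualTotal L) : ℝ :=
  ‖(η.2 (localFrame L η.1 η.1) : ℂ)‖ ^ 2 / h.normSq (localFrame L η.1 η.1)

/-- The disc bundle `D(L*) = {|η|_{h⁻¹} < 1}`, an open subset of `L*`. -/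
def HermitianLineMetric.discBundle (h : HermitianLineMetric I L) : Set (DualTotal L) :=
  {η | h.dualNormSq η < 1}

/-- The differential `dπ` of the projection `π : L* → M`. -/
noncomputable def dualProjDeriv (η : DualTotal L) (U : TangentSpace (dualModel I) η) :
    TangentSpace I η.1 :=
  mfderiv (dualModel I) I
    (TotalSpace.proj : DualTotal L → M) η U

/-- The metric `g_D` with fundamental form `π^* ω_M - √-1 ∂∂̄ log (1 - |η|²_{h⁻¹})`. -/
noncomputable def HermitianLineMetric.discMetric (h : HermitianLineMetric I L)
    (gM : FormField I M) : FormField (dualModel I) (DualTotal L) := fun η U V =>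
  gM η.1 (dualProjDeriv η U) (dualProjDeriv η V) -
    leviForm (dualModel I) (fun ξ : DualTotal L => Real.log (1 - h.dualNormSq ξ)) η U V

end LineBundle

/-! ### Wirtinger calculus to second order. -/

section WirtingerCalculus

variable {E : Type*} [NormedAddCommGroup E] [NormedSpace ℂ E]
  {E' : Type*} [NormedAddCommGroup E'] [NormedSpace ℂ E']

/-! Everything follows from an explicit local potential. For the preferred frame `e` of `L` around a
point put `φ = -log |e|²`, so that `g_M = ∂∂̄φ`. If `v` is the fibre coordinate `η ↦ η(e)`, then
`|η|² = |v|² e^φ`, and with `Φ = φ ∘ π` and `τ = 1 - |v|² e^Φ` the metric `g_D` has the potential `Φ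
- log τ`. Writing `θ = dv + v ∂Φ` for the connection form, `ddbar_discPotential` gives `g_D = g_M /
τ + e^Φ θ θ̄ / τ²`. Smoothness and closedness come from the potential. Positivity holds because a
vector killed by `dπ` and by `θ` is zero.

For the curvature no normalisation at the point is needed. If `w` represents the functional `∂_U
g(U, ·)`, then `R(U, Ū, U, Ū) = g(w, w) - ∂_U ∂̄_U g(U, U)` (`curvatureQuartic_eq`). Differentiating
the formula for `g_D` twice and choosing `w` as a combination of a lift of the base vector, `U`
itself and the vertical direction, all first-order terms cancel and there remains `R_D = (R_M + 2
g_M(X, X)²) / τ - 2 g_D(U, U)²`, which is the asserted formula (`curvatureQuartic_discPotential`,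
`holSectCurvCoord_disc`).

The passage from potentials to the intrinsic objects rests on two facts: `∂∂̄` transforms as a
tensor under holomorphic maps (`ddbar_comp`), and a change of frame alters `φ` by the pluriharmonic
function `log |c|²` (`ddbar_log_norm_sq`).

The adapted coordinates are independent of the curvature computation. A quadratic change of
parameters removes the first derivatives of `g_M` (`exists_geodesic_param`), and multiplying the
frame by the exponential of an affine function makes `|s|² = 1` with vanishing differential at the
point, which turns `θ` into a multiple of `dv` there
(`HermitianLineMetric.exists_adapted_coordinates`). -/

theorem wirtinger_add_right (F : E → ℂ) (x u v : E) :
    wirtinger F x (u + v) = wirtinger F x u + wirtinger F x v := by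
  simp only [wirtinger, smul_add, map_add]; ring

theorem wirtinger_conj (F : E → ℂ) (x u : E) :
    wirtinger (fun y => (starRingEnd ℂ) (F y)) x u = (starRingEnd ℂ) (wirtingerBar F x u) := by
  have h : fderiv ℝ (fun y => (starRingEnd ℂ) (F y)) x
      = (Complex.conjCLE : ℂ →L[ℝ] ℂ).comp (fderiv ℝ F x) :=
    Complex.conjCLE.comp_fderiv (f := F)
  simp only [wirtinger, wirtingerBar, h]
  simp [sub_eq_add_neg, Complex.conj_ofNat]

theorem wirtingerBar_conj (F : E → ℂ) (x u : E) :
    wirtingerBar (fun y => (starRingEnd ℂ) (F y)) x u = (starRingEnd ℂ) (wirtinger F x u) := by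
  have := wirtinger_conj (fun y => (starRingEnd ℂ) (F y)) x u
  simp only [Complex.conj_conj] at this
  rw [this, Complex.conj_conj]

theorem conj_wirtingerBar_ofReal (f : E → ℝ) (x u : E) :
    (starRingEnd ℂ) (wirtingerBar (fun y => (f y : ℂ)) x u) = wirtinger (fun y => (f y : ℂ)) x u := by
  rw [← wirtinger_conj]; simp

theorem conj_wirtinger_ofReal (f : E → ℝ) (x u : E) :
    (starRingEnd ℂ) (wirtinger (fun y => (f y : ℂ)) x u) = wirtingerBar (fun y => (f y : ℂ)) x u := by
  rw [← wirtingerBar_conj]; simp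

theorem smul_real_clm (L : E →L[ℝ] ℂ) (c : ℂ) (u : E) :
    L (c • u) = c.re * L u + c.im * L (Complex.I • u) := by
  have : c • u = c.re • u + c.im • (Complex.I • u) := by
    conv_lhs => rw [← Complex.re_add_im c, add_smul, mul_smul]
    rfl
  rw [this, map_add, map_smul, map_smul]; simp

theorem wirtinger_smul_right (F : E → ℂ) (x : E) (c : ℂ) (u : E) :
    wirtinger F x (c • u) = c * wirtinger F x u := by
  simp only [wirtinger, smul_smul]
  rw [smul_real_clm _ (Complex.I * c), smul_real_clm _ c]
  simp only [Complex.mul_re, Complex.mul_im, Complex.I_re, Complex.I_im, zero_mul, one_mul,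
    zero_sub, zero_add, Complex.ofReal_neg]
  linear_combination (c.im : ℂ) * fderiv ℝ F x (Complex.I • u) / 2 * Complex.I_mul_I
    + (fderiv ℝ F x u - Complex.I * fderiv ℝ F x (Complex.I • u)) / 2 * Complex.re_add_im c

theorem Filter.EventuallyEq.wirtinger_eq {F G : E → ℂ} {x : E} (h : F =ᶠ[nhds x] G) (u : E) :
    wirtinger F x u = wirtinger G x u := by
  simp only [wirtinger, h.fderiv_eq]

theorem Filter.EventuallyEq.wirtingerBar_eq {F G : E → ℂ} {x : E} (h : F =ᶠ[nhds x] G) (u : E) :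
    wirtingerBar F x u = wirtingerBar G x u := by
  simp only [wirtingerBar, h.fderiv_eq]

theorem Filter.EventuallyEq.ddbar_eq {F G : E → ℂ} {x : E} (h : F =ᶠ[nhds x] G) (u v : E) :
    ddbar F x u v = ddbar G x u v :=
  Filter.EventuallyEq.wirtinger_eq (h.eventuallyEq_nhds.mono fun _ hy => hy.wirtingerBar_eq v) u

/-- `F` is real-differentiable at `x` with Wirtinger derivatives `d` and `d'` in direction `u`. -/
structure HasWirtingerAt (F : E → ℂ) (x u : E) (d d' : ℂ) : Prop where
  diff : DifferentiableAt ℝ F x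
  wirt : wirtinger F x u = d
  bar : wirtingerBar F x u = d'

namespace HasWirtingerAt

variable {F G : E → ℂ} {x u : E} {d d' e e' : ℂ}

theorem of_differentiableAt (h : DifferentiableAt ℝ F x) (u : E) :
    HasWirtingerAt F x u (wirtinger F x u) (wirtingerBar F x u) := ⟨h, rfl, rfl⟩

theorem congr_deriv (h : HasWirtingerAt F x u d d') (h1 : d = e) (h2 : d' = e') :
    HasWirtingerAt F x u e e' := h1 ▸ h2 ▸ h

theorem congr_of_eventuallyEq (h : HasWirtingerAt F x u d d') (h1 : G =ᶠ[nhds x] F) :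
    HasWirtingerAt G x u d d' :=
  ⟨h.diff.congr_of_eventuallyEq h1, h1.wirtinger_eq u ▸ h.wirt, h1.wirtingerBar_eq u ▸ h.bar⟩

theorem const (c : ℂ) (x u : E) : HasWirtingerAt (fun _ => c) x u 0 0 :=
  ⟨by fun_prop, by simp [wirtinger], by simp [wirtingerBar]⟩

theorem add (hF : HasWirtingerAt F x u d d') (hG : HasWirtingerAt G x u e e') :
    HasWirtingerAt (fun y => F y + G y) x u (d + e) (d' + e') := by
  obtain ⟨hF, rfl, rfl⟩ := hF
  obtain ⟨hG, rfl, rfl⟩ := hG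
  refine ⟨hF.add hG, ?_, ?_⟩ <;>
  · simp only [wirtinger, wirtingerBar, fderiv_fun_add hF hG, add_apply]; ring

theorem mul (hF : HasWirtingerAt F x u d d') (hG : HasWirtingerAt G x u e e') :
    HasWirtingerAt (fun y => F y * G y) x u (d * G x + F x * e) (d' * G x + F x * e') := by
  obtain ⟨hF, rfl, rfl⟩ := hF
  obtain ⟨hG, rfl, rfl⟩ := hG
  refine ⟨hF.mul hG, ?_, ?_⟩ <;>
  · simp only [wirtinger, wirtingerBar, fderiv_fun_mul hF hG, add_apply,
      FunLike.coe_smul, Pi.smul_apply, smul_eq_mul]; ring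

theorem conj (hF : HasWirtingerAt F x u d d') :
    HasWirtingerAt (fun y => (starRingEnd ℂ) (F y)) x u
      ((starRingEnd ℂ) d') ((starRingEnd ℂ) d) := by
  obtain ⟨hF, rfl, rfl⟩ := hF
  exact ⟨(Complex.conjCLE.differentiableAt (x := F x)).comp x hF, wirtinger_conj _ _ _,
    wirtingerBar_conj _ _ _⟩

theorem comp_hasDerivAt {g : ℂ → ℂ} {g' : ℂ} (hF : HasWirtingerAt F x u d d')
    (hg : HasDerivAt g g' (F x)) :
    HasWirtingerAt (fun y => g (F y)) x u (g' * d) (g' * d') := by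
  obtain ⟨hF, rfl, rfl⟩ := hF
  have h := (hg.hasFDerivAt.restrictScalars ℝ).comp x hF.hasFDerivAt
  refine ⟨h.differentiableAt, ?_, ?_⟩ <;>
  · simp only [wirtinger, wirtingerBar]
    erw [h.fderiv]
    simp; ring

theorem neg (hF : HasWirtingerAt F x u d d') :
    HasWirtingerAt (fun y => -F y) x u (-d) (-d') :=
  ((const (-1) x u).mul hF).congr_of_eventuallyEq (.of_forall fun _ => by simp) |>.congr_deriv
    (by ring) (by ring)

theorem sub (hF : HasWirtingerAt F x u d d') (hG : HasWirtingerAt G x u e e') :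
    HasWirtingerAt (fun y => F y - G y) x u (d - e) (d' - e') := by
  simpa only [sub_eq_add_neg] using hF.add hG.neg

theorem inv (hF : HasWirtingerAt F x u d d') (h0 : F x ≠ 0) :
    HasWirtingerAt (fun y => (F y)⁻¹) x u (-d / F x ^ 2) (-d' / F x ^ 2) :=
  (hF.comp_hasDerivAt (hasDerivAt_inv h0)).congr_deriv (by ring) (by ring)

theorem div (hF : HasWirtingerAt F x u d d') (hG : HasWirtingerAt G x u e e') (h0 : G x ≠ 0) :
    HasWirtingerAt (fun y => F y / G y) x u (d / G x - F x * e / G x ^ 2)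
      (d' / G x - F x * e' / G x ^ 2) := by
  simp only [div_eq_mul_inv]
  exact (hF.mul (hG.inv h0)).congr_deriv (by ring) (by ring)

theorem rexp {f : E → ℝ} (hF : HasWirtingerAt (fun y => (f y : ℂ)) x u d d') :
    HasWirtingerAt (fun y => (Real.exp (f y) : ℂ)) x u (Real.exp (f x) * d)
      (Real.exp (f x) * d') := by
  simp only [Complex.ofReal_exp]
  exact hF.comp_hasDerivAt (Complex.hasDerivAt_exp _)

theorem log {f : E → ℝ} (hF : HasWirtingerAt (fun y => (f y : ℂ)) x u d d') (h0 : 0 < f x) :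
    HasWirtingerAt (fun y => (Real.log (f y) : ℂ)) x u (d / f x) (d' / f x) := by
  have hc : ContinuousAt f x :=
    (Complex.continuous_re.continuousAt).comp (f := fun y => (f y : ℂ)) hF.diff.continuousAt
  have : (fun y => (Real.log (f y) : ℂ)) =ᶠ[nhds x] fun y => Complex.log (f y) := by
    filter_upwards [hc.eventually (lt_mem_nhds h0)] with y hy
    exact Complex.ofReal_log hy.le
  have h1 := Complex.hasDerivAt_log (z := (f x : ℂ)) (Or.inl (by simpa using h0))
  exact ((HasWirtingerAt.comp_hasDerivAt (g := Complex.log) hF h1).congr_of_eventuallyEq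
    this).congr_deriv (by ring) (by ring)

theorem of_holomorphic (h : DifferentiableAt ℂ F x) (u : E) :
    HasWirtingerAt F x u (fderiv ℂ F x u) 0 := by
  have h' := h.hasFDerivAt.restrictScalars ℝ
  refine ⟨h'.differentiableAt, ?_, ?_⟩ <;>
  · simp only [wirtinger, wirtingerBar, h'.fderiv, ContinuousLinearMap.coe_restrictScalars',
      map_smul, smul_eq_mul, ← mul_assoc, Complex.I_mul_I]
    ring

theorem clm (L : E →L[ℂ] ℂ) (x u : E) : HasWirtingerAt (fun y => L y) x u (L u) 0 := by
  simpa using of_holomorphic (L.differentiableAt (x := x)) u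

end HasWirtingerAt

theorem wirtinger_comp {F : E → ℂ} {φ : E' → E} {y : E'} (hF : DifferentiableAt ℝ F (φ y))
    (hφ : DifferentiableAt ℂ φ y) (u : E') :
    wirtinger (fun z => F (φ z)) y u = wirtinger F (φ y) (fderiv ℂ φ y u) := by
  have h := hF.hasFDerivAt.comp y (hφ.hasFDerivAt.restrictScalars ℝ)
  simp only [wirtinger]
  erw [h.fderiv]
  simp

theorem wirtingerBar_comp {F : E → ℂ} {φ : E' → E} {y : E'} (hF : DifferentiableAt ℝ F (φ y))
    (hφ : DifferentiableAt ℂ φ y) (u : E') :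
    wirtingerBar (fun z => F (φ z)) y u = wirtingerBar F (φ y) (fderiv ℂ φ y u) := by
  have h := hF.hasFDerivAt.comp y (hφ.hasFDerivAt.restrictScalars ℝ)
  simp only [wirtingerBar]
  erw [h.fderiv]
  simp

theorem ContDiffAt.wirtinger {F : E → ℂ} {x : E} {m n : WithTop ℕ∞} (hF : ContDiffAt ℝ n F x)
    (h : m + 1 ≤ n) (u : E) : ContDiffAt ℝ m (fun y => wirtinger F y u) x := by
  have := hF.fderiv_right h
  unfold _root_.wirtinger
  fun_prop

theorem ContDiffAt.wirtingerBar {F : E → ℂ} {x : E} {m n : WithTop ℕ∞} (hF : ContDiffAt ℝ n F x)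
    (h : m + 1 ≤ n) (u : E) : ContDiffAt ℝ m (fun y => wirtingerBar F y u) x := by
  have := hF.fderiv_right h
  unfold _root_.wirtingerBar
  fun_prop

theorem ContDiffAt.ddbar {F : E → ℂ} {x : E} {m n : WithTop ℕ∞} (hF : ContDiffAt ℝ n F x)
    (h : m + 2 ≤ n) (u v : E) : ContDiffAt ℝ m (fun y => ddbar F y u v) x := by
  rw [← one_add_one_eq_two, ← add_assoc] at h
  exact (hF.wirtingerBar h v).wirtinger le_rfl u

section Second

variable {F : E → ℂ} {x : E}

theorem fderiv_wirtinger (hF : ContDiffAt ℝ 2 F x) (u c : E) :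
    fderiv ℝ (fun y => wirtinger F y u) x c =
      (fderiv ℝ (fderiv ℝ F) x c u - Complex.I * fderiv ℝ (fderiv ℝ F) x c (Complex.I • u)) / 2 := by
  have h : DifferentiableAt ℝ (fderiv ℝ F) x :=
    (hF.fderiv_right (m := 1) (by norm_num)).differentiableAt (by norm_num)
  have h1 := (((h.hasFDerivAt.clm_apply (hasFDerivAt_const u x)).sub
    ((h.hasFDerivAt.clm_apply (hasFDerivAt_const (Complex.I • u) x)).const_mul
      Complex.I)).mul_const (2⁻¹ : ℂ))
  simp only [wirtinger, div_eq_mul_inv]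
  erw [h1.fderiv]
  simp
  ring

theorem fderiv_wirtingerBar (hF : ContDiffAt ℝ 2 F x) (u c : E) :
    fderiv ℝ (fun y => wirtingerBar F y u) x c =
      (fderiv ℝ (fderiv ℝ F) x c u + Complex.I * fderiv ℝ (fderiv ℝ F) x c (Complex.I • u)) / 2 := by
  have h : DifferentiableAt ℝ (fderiv ℝ F) x :=
    (hF.fderiv_right (m := 1) (by norm_num)).differentiableAt (by norm_num)
  have h1 := (((h.hasFDerivAt.clm_apply (hasFDerivAt_const u x)).add
    ((h.hasFDerivAt.clm_apply (hasFDerivAt_const (Complex.I • u) x)).const_mul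
      Complex.I)).mul_const (2⁻¹ : ℂ))
  simp only [wirtingerBar, div_eq_mul_inv]
  erw [h1.fderiv]
  simp
  ring

theorem fderiv_fderiv_symm (hF : ContDiffAt ℝ 2 F x) (u v : E) :
    fderiv ℝ (fderiv ℝ F) x u v = fderiv ℝ (fderiv ℝ F) x v u :=
  (hF.isSymmSndFDerivAt (by simp)) u v

/-- Symmetry of the real second derivative. Applied to `∂̄_b` of a potential it is the Kähler
condition, used for closedness and again for geodesic parameters. -/
theorem wirtinger_wirtinger_comm (hF : ContDiffAt ℝ 2 F x) (u v : E) :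
    wirtinger (fun y => wirtinger F y v) x u = wirtinger (fun y => wirtinger F y u) x v := by
  simp only [wirtinger.eq_1 (fun y => wirtinger F y _), fderiv_wirtinger hF]
  rw [fderiv_fderiv_symm hF v u, fderiv_fderiv_symm hF v (Complex.I • u),
    fderiv_fderiv_symm hF (Complex.I • v) u, fderiv_fderiv_symm hF (Complex.I • v) (Complex.I • u)]
  ring

/-- `∂_u ∂̄_v = ∂̄_v ∂_u`. -/
theorem ddbar_eq_wirtingerBar_wirtinger (hF : ContDiffAt ℝ 2 F x) (u v : E) :
    ddbar F x u v = wirtingerBar (fun y => wirtinger F y u) x v := by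
  simp only [ddbar, wirtinger.eq_1 (fun y => wirtingerBar F y _),
    wirtingerBar.eq_1 (fun y => wirtinger F y _), fderiv_wirtinger hF, fderiv_wirtingerBar hF]
  rw [fderiv_fderiv_symm hF v u, fderiv_fderiv_symm hF v (Complex.I • u),
    fderiv_fderiv_symm hF (Complex.I • v) u, fderiv_fderiv_symm hF (Complex.I • v) (Complex.I • u)]
  ring

theorem ddbar_eq_second (hF : ContDiffAt ℝ 2 F x) (u v : E) :
    ddbar F x u v = (fderiv ℝ (fderiv ℝ F) x u v + Complex.I * fderiv ℝ (fderiv ℝ F) x u (Complex.I • v)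
      - Complex.I * fderiv ℝ (fderiv ℝ F) x (Complex.I • u) v
      + fderiv ℝ (fderiv ℝ F) x (Complex.I • u) (Complex.I • v)) / 4 := by
  simp only [ddbar, wirtinger.eq_1 (fun y => wirtingerBar F y _), fderiv_wirtingerBar hF]
  linear_combination (-(fderiv ℝ (fderiv ℝ F) x (Complex.I • u) (Complex.I • v)) / 4) *
    Complex.I_mul_I

theorem ddbar_add_left (F : E → ℂ) (x u u' v : E) :
    ddbar F x (u + u') v = ddbar F x u v + ddbar F x u' v := wirtinger_add_right _ _ _ _

theorem ddbar_smul_left (F : E → ℂ) (x : E) (c : ℂ) (u v : E) :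
    ddbar F x (c • u) v = c * ddbar F x u v := wirtinger_smul_right _ _ _ _

theorem conj_ddbar_ofReal {f : E → ℝ} (hf : ContDiffAt ℝ 2 (fun y => (f y : ℂ)) x) (u v : E) :
    (starRingEnd ℂ) (ddbar (fun y => (f y : ℂ)) x u v) = ddbar (fun y => (f y : ℂ)) x v u := by
  rw [ddbar_eq_wirtingerBar_wirtinger hf v u, ddbar, ← wirtingerBar_conj]
  simp only [conj_wirtingerBar_ofReal]

/-- The first derivative of `F` meets the second derivative of `φ` in four terms. Since that second
derivative is complex bilinear, they cancel by `I² = -1`, so `∂∂̄` is a tensor under holomorphic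
maps. -/
theorem ddbar_comp {φ : E' → E} {y : E'} (hF : ContDiffAt ℝ 2 F (φ y))
    (hφ : ContDiffAt ℂ 2 φ y) (u v : E') :
    ddbar (fun z => F (φ z)) y u v = ddbar F (φ y) (fderiv ℂ φ y u) (fderiv ℂ φ y v) := by
  have hφ' : DifferentiableAt ℂ φ y := hφ.differentiableAt (by norm_num)
  have hφr : ContDiffAt ℝ 2 φ y := hφ.restrict_scalars ℝ
  have hev : (fun z => wirtingerBar (fun z => F (φ z)) z v) =ᶠ[nhds y]
      fun z => wirtingerBar F (φ z) (fderiv ℂ φ z v) := by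
    have h1 := hφ.continuousAt.eventually (hF.eventually (by norm_num))
    filter_upwards [h1, hφ.eventually (by norm_num)] with z hz1 hz2
    exact wirtingerBar_comp (hz1.differentiableAt (by norm_num)) (hz2.differentiableAt (by norm_num)) v
  have hL : DifferentiableAt ℝ (fderiv ℝ F) (φ y) :=
    (hF.fderiv_right (m := 1) (by norm_num)).differentiableAt (by norm_num)
  have hL' := hL.hasFDerivAt.comp y (hφ'.hasFDerivAt.restrictScalars ℝ)
  have hD : DifferentiableAt ℂ (fderiv ℂ φ) y :=
    (hφ.fderiv_right (m := 1) (by norm_num)).differentiableAt (by norm_num)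
  have hv : HasFDerivAt (fun z => fderiv ℂ φ z v) ((fderiv ℂ (fderiv ℂ φ) y).flip v) y := by
    simpa using hD.hasFDerivAt.clm_apply (hasFDerivAt_const v y)
  have hv' := hv.restrictScalars ℝ
  have hv2 := hv'.const_smul Complex.I
  have h1 := ((hL'.clm_apply hv').add ((hL'.clm_apply hv2).const_mul Complex.I)).mul_const (2⁻¹ : ℂ)
  rw [ddbar, hev.wirtinger_eq, ddbar_eq_second hF]
  simp only [wirtinger, wirtingerBar, div_eq_mul_inv]
  erw [h1.fderiv]
  simp [smul_smul]
  linear_combination (fderiv ℝ F (φ y) (fderiv ℂ (fderiv ℂ φ) y u v) / 4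
    - fderiv ℝ (fderiv ℝ F) (φ y) (Complex.I • fderiv ℂ φ y u) (Complex.I • fderiv ℂ φ y v) / 4) *
      Complex.I_mul_I

end Second

end WirtingerCalculus

/-! ### Linear algebra of Hermitian inner products. -/

namespace IsHermitianInner

variable {V : Type*} [AddCommGroup V] [Module ℂ V] {g : V → V → ℂ} (hg : IsHermitianInner g)
include hg

theorem zero_left (w : V) : g 0 w = 0 := by
  simpa using hg.smul_left 0 0 w

theorem add_right (u v w : V) : g u (v + w) = g u v + g u w := by
  rw [hg.conj_symm, hg.add_left, map_add, ← hg.conj_symm, ← hg.conj_symm]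

theorem smul_right (c : ℂ) (u w : V) : g u (c • w) = (starRingEnd ℂ) c * g u w := by
  rw [hg.conj_symm, hg.smul_left, map_mul, ← hg.conj_symm]

theorem sum_left {ι : Type*} (s : Finset ι) (f : ι → V) (w : V) :
    g (∑ i ∈ s, f i) w = ∑ i ∈ s, g (f i) w :=
  map_sum (AddMonoidHom.mk' (fun u => g u w) fun u v => hg.add_left u v w) f s

theorem sum_right {ι : Type*} (s : Finset ι) (f : ι → V) (w : V) :
    g w (∑ i ∈ s, f i) = ∑ i ∈ s, g w (f i) :=
  map_sum (AddMonoidHom.mk' (fun u => g w u) fun u v => hg.add_right w u v) f s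

theorem im_self (u : V) : (g u u).im = 0 :=
  Complex.conj_eq_iff_im.1 (hg.conj_symm u u).symm

theorem ofReal_re_self (u : V) : ((g u u).re : ℂ) = g u u :=
  Complex.ext (by simp) (by simp [hg.im_self])

theorem eq_zero_of_self (u : V) (h : g u u = 0) : u = 0 := by
  by_contra hu
  have := hg.pos u hu
  simp [h] at this

theorem nonneg (u : V) : 0 ≤ (g u u).re := by
  by_cases hu : u = 0
  · simp [hu, hg.zero_left]
  · exact (hg.pos u hu).le

/-- Gram–Schmidt: a Hermitian inner product has an orthonormal basis. -/
theorem exists_orthonormal_basis [FiniteDimensional ℂ V] :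
    ∃ b : Module.Basis (Fin (Module.finrank ℂ V)) ℂ V,
      ∀ i j, g (b i) (b j) = if i = j then 1 else 0 := by
  let core : InnerProductSpace.Core ℂ V :=
    { inner := fun u w => g w u
      conj_inner_symm := fun u w => (hg.conj_symm u w).symm ▸ by simp
      re_inner_nonneg := fun u => hg.nonneg u
      add_left := fun u v w => hg.add_right w u v
      smul_left := fun u w c => hg.smul_right c w u
      definite := fun u h => hg.eq_zero_of_self u h }
  let _ : NormedAddCommGroup V := core.toNormedAddCommGroup
  let _ : InnerProductSpace ℂ V := InnerProductSpace.ofCore core.toCore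
  refine ⟨(stdOrthonormalBasis ℂ V).toBasis, fun i j => ?_⟩
  have := orthonormal_iff_ite.1 (stdOrthonormalBasis ℂ V).orthonormal j i
  simp only [OrthonormalBasis.coe_toBasis]
  rw [show g _ _ = _ from this]
  simp [eq_comm]

/-- The representing vector is kept explicit, because in `exists_geodesic_param` it must depend
bilinearly on parameters. -/
theorem eq_sum_of_conj_linear {ι : Type*} [Fintype ι] [DecidableEq ι]
    {e : Module.Basis ι ℂ V} (he : ∀ i j, g (e i) (e j) = if i = j then 1 else 0) {ℓ : V → ℂ}
    (hadd : ∀ u v, ℓ (u + v) = ℓ u + ℓ v)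
    (hsmul : ∀ (c : ℂ) u, ℓ (c • u) = (starRingEnd ℂ) c * ℓ u) (b : V) :
    ℓ b = g (∑ i, ℓ (e i) • e i) b := by
  have hs : ∀ c : ι → ℂ, ℓ (∑ i, c i • e i) = ∑ i, (starRingEnd ℂ) (c i) * ℓ (e i) := fun c => by
    rw [show ℓ (∑ i, c i • e i) = ∑ i, ℓ (c i • e i) from map_sum (AddMonoidHom.mk' ℓ hadd) _ _]
    simp only [hsmul]
  conv_lhs => rw [← e.sum_repr b]
  conv_rhs => rw [← e.sum_repr b]
  rw [hs, hg.sum_right]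
  refine Finset.sum_congr rfl fun i _ => ?_
  rw [hg.smul_right, hg.sum_left]
  simp [hg.smul_left, he]

/-- Riesz representation of conjugate linear functionals. -/
theorem exists_eq_of_conj_linear [FiniteDimensional ℂ V] (ℓ : V → ℂ)
    (hadd : ∀ u v, ℓ (u + v) = ℓ u + ℓ v)
    (hsmul : ∀ (c : ℂ) u, ℓ (c • u) = (starRingEnd ℂ) c * ℓ u) : ∃ w, ∀ b, ℓ b = g w b := by
  obtain ⟨e, he⟩ := hg.exists_orthonormal_basis
  exact ⟨_, hg.eq_sum_of_conj_linear he hadd hsmul⟩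

end IsHermitianInner

/-! ### The curvature without inverting the metric matrix. -/

section Curvature

variable {E : Type*} [NormedAddCommGroup E] [NormedSpace ℂ E] [FiniteDimensional ℂ E]

/-- If `r = w T` then `r T⁻¹ r^* = w r^*`, which is the squared length of `w`. A guess for `w` thus
replaces the computation of `T⁻¹`. -/
theorem curvatureQuartic_eq {G : E → E → E → ℂ} {x : E} (hG : IsHermitianInner (G x)) {u w : E}
    (hw : ∀ b, wirtinger (fun y => G y u b) x u = G x w b) :
    curvatureQuartic G x u = G x w w - ddbar (fun y => G y u u) x u u := by
  set e := Module.finBasis ℂ E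
  have hv : ∀ c : Fin (Module.finrank ℂ E) → ℂ, ∀ k,
      Matrix.vecMul c (metricMatrix (G x)) k = G x (∑ i, c i • e i) (e k) := fun c k => by
    simp [Matrix.vecMul, dotProduct, metricMatrix, hG.sum_left, hG.smul_left, e]
  -- A row vector in the kernel of `T` gives the coordinates of a vector of length zero.
  have hunit : IsUnit (metricMatrix (G x)) := by
    rw [← Matrix.vecMul_injective_iff_isUnit]
    refine (injective_iff_map_eq_zero (Matrix.vecMulLinear (metricMatrix (G x)))).2 fun c hc => ?_
    have h0 : ∑ i, c i • e i = 0 := by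
      refine hG.eq_zero_of_self _ ?_
      conv_lhs => rw [hG.sum_right]
      refine Finset.sum_eq_zero fun k _ => ?_
      rw [hG.smul_right, ← hv, show Matrix.vecMul c (metricMatrix (G x)) = 0 from hc]
      simp
    exact funext fun i => Fintype.linearIndependent_iff.1 e.linearIndependent c h0 i
  have hr : (fun k => wirtinger (fun y => G y u (e k)) x u)
      = Matrix.vecMul (e.repr w) (metricMatrix (G x)) := by
    funext k
    rw [hv, e.sum_repr, hw]
  have hdet : IsUnit (metricMatrix (G x)).det := (Matrix.isUnit_iff_isUnit_det _).1 hunit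
  simp only [curvatureQuartic]
  rw [hr, Matrix.vecMul_vecMul, Matrix.mul_nonsing_inv _ hdet, Matrix.vecMul_one, ← hr]
  congr 1
  rw [hG.conj_symm]
  conv_rhs => enter [2]; rw [← e.sum_repr w]
  conv_rhs => rw [hG.sum_right, map_sum]
  refine Finset.sum_congr rfl fun k _ => ?_
  rw [hG.smul_right, e.sum_repr]
  simp [hw]

end Curvature

/-! ### The potential `Φ - log (1 - |v|² e^Φ)` and its metric. -/

section DiscPotential

variable {E : Type*} [NormedAddCommGroup E] [NormedSpace ℂ E]

/-- `1 - |v|² e^Φ`. -/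
noncomputable def discDefect (v : E →L[ℂ] ℂ) (Φ : E → ℝ) (y : E) : ℝ :=
  1 - ‖v y‖ ^ 2 * Real.exp (Φ y)

/-- `Φ - log (1 - |v|² e^Φ)`. -/
noncomputable def discPotential (v : E →L[ℂ] ℂ) (Φ : E → ℝ) (y : E) : ℝ :=
  Φ y - Real.log (discDefect v Φ y)

/-- The connection form `dv + v ∂Φ`. -/
noncomputable def connForm (v : E →L[ℂ] ℂ) (Φ : E → ℝ) (y u : E) : ℂ :=
  v u + v y * wirtinger (fun z => (Φ z : ℂ)) y u

variable {v : E →L[ℂ] ℂ} {Φ : E → ℝ} {x : E}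

theorem hasWirtingerAt_ofReal (hΦ : DifferentiableAt ℝ (fun y => (Φ y : ℂ)) x) (u : E) :
    HasWirtingerAt (fun y => (Φ y : ℂ)) x u (wirtinger (fun y => (Φ y : ℂ)) x u)
      ((starRingEnd ℂ) (wirtinger (fun y => (Φ y : ℂ)) x u)) :=
  ⟨hΦ, rfl, (conj_wirtinger_ofReal Φ x u).symm⟩

/-- The connection form enters here: `∂(v v̄ e^Φ) = e^Φ v̄ (dv + v ∂Φ)`. -/
theorem hasWirtingerAt_discDefect (hΦ : DifferentiableAt ℝ (fun y => (Φ y : ℂ)) x) (u : E) :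
    HasWirtingerAt (fun y => (discDefect v Φ y : ℂ)) x u
      (-(Real.exp (Φ x) * (starRingEnd ℂ) (v x) * connForm v Φ x u))
      (-(Real.exp (Φ x) * v x * (starRingEnd ℂ) (connForm v Φ x u))) := by
  have hv := HasWirtingerAt.clm v x u
  have h := (HasWirtingerAt.const 1 x u).sub ((hv.mul hv.conj).mul (hasWirtingerAt_ofReal hΦ u).rexp)
  refine (h.congr_of_eventuallyEq (.of_forall fun y => ?_)).congr_deriv ?_ ?_
  · simp [discDefect, Complex.mul_conj, Complex.normSq_eq_norm_sq]
  · simp only [connForm, map_zero]; ring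
  · simp only [connForm, map_add, map_mul]; ring

theorem hasWirtingerAt_wirtinger_ofReal (hΦ : ContDiffAt ℝ 2 (fun y => (Φ y : ℂ)) x) (u c : E) :
    HasWirtingerAt (fun y => wirtinger (fun z => (Φ z : ℂ)) y u) x c
      (wirtinger (fun y => wirtinger (fun z => (Φ z : ℂ)) y u) x c)
      (ddbar (fun y => (Φ y : ℂ)) x u c) :=
  ⟨(hΦ.wirtinger (m := 1) (by norm_num) u).differentiableAt (by norm_num), rfl,
    (ddbar_eq_wirtingerBar_wirtinger hΦ u c).symm⟩

theorem hasWirtingerAt_connForm (hΦ : ContDiffAt ℝ 2 (fun y => (Φ y : ℂ)) x) (u c : E) :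
    HasWirtingerAt (fun y => connForm v Φ y u) x c
      (v c * wirtinger (fun z => (Φ z : ℂ)) x u
        + v x * wirtinger (fun y => wirtinger (fun z => (Φ z : ℂ)) y u) x c)
      (v x * ddbar (fun y => (Φ y : ℂ)) x u c) :=
  ((HasWirtingerAt.const (v u) x c).add ((HasWirtingerAt.clm v x c).mul
    (hasWirtingerAt_wirtinger_ofReal hΦ u c))).congr_deriv (by ring) (by ring)

theorem hasWirtingerAt_discPotential (hΦ : DifferentiableAt ℝ (fun y => (Φ y : ℂ)) x)
    (hτ : 0 < discDefect v Φ x) (b : E) :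
    HasWirtingerAt (fun y => (discPotential v Φ y : ℂ)) x b
      (wirtinger (fun z => (Φ z : ℂ)) x b
        + Real.exp (Φ x) * (starRingEnd ℂ) (v x) * connForm v Φ x b / discDefect v Φ x)
      ((starRingEnd ℂ) (wirtinger (fun z => (Φ z : ℂ)) x b)
        + Real.exp (Φ x) * v x * (starRingEnd ℂ) (connForm v Φ x b) / discDefect v Φ x) := by
  have h := (hasWirtingerAt_ofReal hΦ b).sub ((hasWirtingerAt_discDefect (v := v) hΦ b).log hτ)
  refine (h.congr_of_eventuallyEq (.of_forall fun y => ?_)).congr_deriv ?_ ?_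
  · simp [discPotential]
  · ring
  · ring

theorem continuousAt_discDefect (hΦ : ContinuousAt (fun y => (Φ y : ℂ)) x) :
    ContinuousAt (discDefect v Φ) x := by
  have : ContinuousAt Φ x := Complex.continuous_re.continuousAt.comp (f := fun y => (Φ y : ℂ)) hΦ
  unfold discDefect
  fun_prop

theorem contDiffAt_discDefect {n : WithTop ℕ∞} (hΦ : ContDiffAt ℝ n Φ x) :
    ContDiffAt ℝ n (discDefect v Φ) x := by
  have hv : ContDiffAt ℝ n (fun y => ‖v y‖ ^ 2) x :=
    ((v.restrictScalars ℝ).contDiff.norm_sq ℝ).contDiffAt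
  unfold discDefect
  exact contDiffAt_const.sub (hv.mul hΦ.exp)

theorem contDiffAt_discPotential {n : WithTop ℕ∞} (hΦ : ContDiffAt ℝ n Φ x)
    (hτ : 0 < discDefect v Φ x) : ContDiffAt ℝ n (discPotential v Φ) x :=
  hΦ.sub ((contDiffAt_discDefect hΦ).log hτ.ne')

theorem ContDiffAt.ofReal {n : WithTop ℕ∞} (hΦ : ContDiffAt ℝ n Φ x) :
    ContDiffAt ℝ n (fun y => (Φ y : ℂ)) x :=
  Complex.ofRealCLM.contDiff.contDiffAt.comp x hΦ

theorem ContDiffAt.of_ofReal {n : WithTop ℕ∞} (hΦ : ContDiffAt ℝ n (fun y => (Φ y : ℂ)) x) :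
    ContDiffAt ℝ n Φ x :=
  Complex.reCLM.contDiff.contDiffAt.comp x hΦ

theorem discDefect_eq (v : E →L[ℂ] ℂ) (Φ : E → ℝ) (x : E) : (discDefect v Φ x : ℂ) =
    1 - v x * (starRingEnd ℂ) (v x) * Real.exp (Φ x) := by
  simp [discDefect, Complex.mul_conj, Complex.normSq_eq_norm_sq]

/-- From `∂̄_b K = ∂̄_b Φ + e^Φ v θ̄_b / τ`. Differentiating `θ̄_b` produces `v̄ ∂∂̄Φ`, so the
coefficient of `∂∂̄Φ` is `1 + |v|² e^Φ / τ = 1 / τ`. -/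
theorem ddbar_discPotential (hΦ : ContDiffAt ℝ 2 (fun y => (Φ y : ℂ)) x)
    (hτ : 0 < discDefect v Φ x) (u b : E) :
    ddbar (fun y => (discPotential v Φ y : ℂ)) x u b =
      ddbar (fun y => (Φ y : ℂ)) x u b / discDefect v Φ x
      + Real.exp (Φ x) * connForm v Φ x u * (starRingEnd ℂ) (connForm v Φ x b)
        / discDefect v Φ x ^ 2 := by
  have hd : DifferentiableAt ℝ (fun y => (Φ y : ℂ)) x := hΦ.differentiableAt (by norm_num)
  have hev : (fun y => wirtingerBar (fun y => (discPotential v Φ y : ℂ)) y b) =ᶠ[nhds x] fun y =>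
      (starRingEnd ℂ) (wirtinger (fun z => (Φ z : ℂ)) y b)
        + Real.exp (Φ y) * v y * (starRingEnd ℂ) (connForm v Φ y b) / discDefect v Φ y := by
    filter_upwards [hΦ.eventually (by norm_num),
      (continuousAt_discDefect hΦ.continuousAt).eventually (lt_mem_nhds hτ)] with y h1 h2
    exact (hasWirtingerAt_discPotential (h1.differentiableAt (by norm_num)) h2 b).bar
  have hne : (discDefect v Φ x : ℂ) ≠ 0 := by exact_mod_cast hτ.ne'
  rw [ddbar, hev.wirtinger_eq]
  rw [((hasWirtingerAt_wirtinger_ofReal hΦ b u).conj.add ((((hasWirtingerAt_ofReal hd u).rexp.mul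
    (HasWirtingerAt.clm v x u)).mul (hasWirtingerAt_connForm hΦ b u).conj).div
      (hasWirtingerAt_discDefect hd u) hne)).wirt]
  simp only [map_mul, conj_ddbar_ofReal hΦ]
  -- Eliminating `dv` in favour of `θ` leaves the definition of `τ` as the only relation needed.
  have hv : v u = connForm v Φ x u - v x * wirtinger (fun z => (Φ z : ℂ)) x u := by simp [connForm]
  rw [hv]
  have hT := discDefect_eq v Φ x
  set T : ℂ := (discDefect v Φ x : ℂ)
  field_simp
  linear_combination (ddbar (fun y => (Φ y : ℂ)) x u b * T + Real.exp (Φ x) * connForm v Φ x u *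
    (starRingEnd ℂ) (connForm v Φ x b)) * hT

end DiscPotential

/-! ### First and second derivatives of the disc metric. -/

section DiscCurvature

variable {E : Type*} [NormedAddCommGroup E] [NormedSpace ℂ E]
  {v : E →L[ℂ] ℂ} {Φ : E → ℝ} {x : E}

theorem eventually_ddbar_discPotential (hΦ : ContDiffAt ℝ 2 (fun y => (Φ y : ℂ)) x)
    (hτ : 0 < discDefect v Φ x) :
    ∀ᶠ y in nhds x, ∀ u b, ddbar (fun y => (discPotential v Φ y : ℂ)) y u b =
      ddbar (fun y => (Φ y : ℂ)) y u b / discDefect v Φ y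
      + Real.exp (Φ y) * connForm v Φ y u * (starRingEnd ℂ) (connForm v Φ y b)
        / discDefect v Φ y ^ 2 := by
  filter_upwards [hΦ.eventually (by norm_num),
    (continuousAt_discDefect hΦ.continuousAt).eventually (lt_mem_nhds hτ)] with y h1 h2 u b
  exact ddbar_discPotential h1 h2 u b

/-- The vertical part of `∂_u` of the metric with potential `discPotential`. -/
noncomputable def discShear (v : E →L[ℂ] ℂ) (Φ : E → ℝ) (y u : E) : ℂ :=
  wirtinger (fun z => (Φ z : ℂ)) y u * connForm v Φ y u
    + (v u * wirtinger (fun z => (Φ z : ℂ)) y u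
        + v y * wirtinger (fun z => wirtinger (fun z => (Φ z : ℂ)) z u) y u)
    + 2 * connForm v Φ y u *
      (Real.exp (Φ y) * (starRingEnd ℂ) (v y) * connForm v Φ y u) / discDefect v Φ y

/-- Of the two equal terms `p g / τ²`, with `p = e^Φ v̄ θ_u`, one comes from `1 / τ` and the other
from `∂_u θ̄_b = v̄ g(u, b)`. The result has the shape of the metric itself: a base part over `τ`
plus a scalar times `e^Φ θ̄_b / τ²`. Hence a representing vector can be read off. -/
theorem wirtinger_ddbar_discPotential (hΦ : ContDiffAt ℝ 3 (fun y => (Φ y : ℂ)) x)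
    (hτ : 0 < discDefect v Φ x) (u b : E) :
    wirtinger (fun y => ddbar (fun y => (discPotential v Φ y : ℂ)) y u b) x u =
      wirtinger (fun y => ddbar (fun y => (Φ y : ℂ)) y u b) x u / discDefect v Φ x
      + 2 * (Real.exp (Φ x) * (starRingEnd ℂ) (v x) * connForm v Φ x u) *
        ddbar (fun y => (Φ y : ℂ)) x u b / discDefect v Φ x ^ 2
      + discShear v Φ x u * Real.exp (Φ x) * (starRingEnd ℂ) (connForm v Φ x b)
        / discDefect v Φ x ^ 2 := by
  have hΦ2 : ContDiffAt ℝ 2 (fun y => (Φ y : ℂ)) x := hΦ.of_le (by norm_num)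
  have hd : DifferentiableAt ℝ (fun y => (Φ y : ℂ)) x := hΦ2.differentiableAt (by norm_num)
  have hev := (eventually_ddbar_discPotential hΦ2 hτ).mono fun y hy => hy u b
  have hne : (discDefect v Φ x : ℂ) ≠ 0 := by exact_mod_cast hτ.ne'
  have hg := HasWirtingerAt.of_differentiableAt
    ((hΦ.ddbar (m := 1) (by norm_num) u b).differentiableAt (by norm_num)) u
  have hT := hasWirtingerAt_discDefect (v := v) hd u
  rw [Filter.EventuallyEq.wirtinger_eq hev]
  simp only [pow_two]
  rw [((hg.div hT hne).add ((((hasWirtingerAt_ofReal hd u).rexp.mul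
    (hasWirtingerAt_connForm hΦ2 u u)).mul (hasWirtingerAt_connForm hΦ2 b u).conj).div
      (hT.mul hT) (mul_ne_zero hne hne))).wirt]
  simp only [map_mul, conj_ddbar_ofReal hΦ2, discShear]
  have hv : v u = connForm v Φ x u - v x * wirtinger (fun z => (Φ z : ℂ)) x u := by simp [connForm]
  rw [hv]
  field_simp
  ring

/-- The grouping is chosen for the later subtraction: the terms in `g'`, `p p̄` and `A Ā` are those
of the length of the representing vector, and only `Q` and the squares of the two metrics survive.
-/
theorem wirtingerBar_wirtinger_ddbar_discPotential (hΦ : ContDiffAt ℝ 4 (fun y => (Φ y : ℂ)) x)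
    (hτ : 0 < discDefect v Φ x) (u : E) :
    let g := ddbar (fun y => (Φ y : ℂ)) x u u
    let g' := wirtinger (fun y => ddbar (fun y => (Φ y : ℂ)) y u u) x u
    let Q := ddbar (fun y => ddbar (fun y => (Φ y : ℂ)) y u u) x u u
    let T : ℂ := discDefect v Φ x
    let e : ℂ := Real.exp (Φ x)
    let θ := connForm v Φ x u
    let A := discShear v Φ x u
    let p := e * (starRingEnd ℂ) (v x) * θ
    ddbar (fun y => ddbar (fun y => (discPotential v Φ y : ℂ)) y u u) x u u =
      Q / T + 2 * (p * (starRingEnd ℂ) g' + (starRingEnd ℂ) p * g') / T ^ 2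
      + 4 * p * (starRingEnd ℂ) p * g / T ^ 3 + e * A * (starRingEnd ℂ) A / T ^ 2
      + 2 * (g / T + e * θ * (starRingEnd ℂ) θ / T ^ 2) ^ 2 - 2 * g ^ 2 / T := by
  intro g g' Q T e θ A p
  have hΦ3 : ContDiffAt ℝ 3 (fun y => (Φ y : ℂ)) x := hΦ.of_le (by norm_num)
  have hΦ2 : ContDiffAt ℝ 2 (fun y => (Φ y : ℂ)) x := hΦ.of_le (by norm_num)
  have hd : DifferentiableAt ℝ (fun y => (Φ y : ℂ)) x := hΦ2.differentiableAt (by norm_num)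
  have hne : T ≠ 0 := by simpa [T] using hτ.ne'
  have hK : ContDiffAt ℝ 4 (fun y => (discPotential v Φ y : ℂ)) x :=
    (contDiffAt_discPotential hΦ.of_ofReal hτ).ofReal
  have hgc : ContDiffAt ℝ 2 (fun y => ddbar (fun y => (Φ y : ℂ)) y u u) x :=
    hΦ.ddbar (by norm_num) u u
  have hg : HasWirtingerAt (fun y => ddbar (fun y => (Φ y : ℂ)) y u u) x u g'
      ((starRingEnd ℂ) g') := by
    refine ⟨hgc.differentiableAt (by norm_num), rfl, ?_⟩
    rw [← wirtingerBar_conj]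
    refine Filter.EventuallyEq.wirtingerBar_eq ?_ u
    filter_upwards [hΦ2.eventually (by norm_num)] with y hy
    exact (conj_ddbar_ofReal hy u u).symm
  have hg1 : HasWirtingerAt (fun y => wirtinger (fun y => ddbar (fun y => (Φ y : ℂ)) y u u) y u) x u
      _ Q :=
    ⟨(hgc.wirtinger (m := 1) (by norm_num) u).differentiableAt (by norm_num), rfl,
      (ddbar_eq_wirtingerBar_wirtinger hgc u u).symm⟩
  have hΦu : ContDiffAt ℝ 2 (fun y => wirtinger (fun z => (Φ z : ℂ)) y u) x :=
    hΦ3.wirtinger (by norm_num) u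
  -- `∂̄_u ∂_u ∂_u Φ = ∂_u (∂_u ∂̄_u Φ)`, so no derivative beyond `g'` is introduced.
  have hΦuu : HasWirtingerAt
      (fun y => wirtinger (fun z => wirtinger (fun z => (Φ z : ℂ)) z u) y u) x u
      (wirtinger (fun y => wirtinger (fun z => wirtinger (fun z => (Φ z : ℂ)) z u) y u) x u) g' := by
    refine ⟨(hΦu.wirtinger (m := 1) (by norm_num) u).differentiableAt (by norm_num), rfl, ?_⟩
    rw [← ddbar_eq_wirtingerBar_wirtinger hΦu]
    refine Filter.EventuallyEq.wirtinger_eq ?_ u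
    filter_upwards [hΦ2.eventually (by norm_num)] with y hy
    exact (ddbar_eq_wirtingerBar_wirtinger hy u u).symm
  have hev := ((hΦ3.eventually (by norm_num)).and
    ((continuousAt_discDefect hΦ.continuousAt).eventually (lt_mem_nhds hτ))).mono
      fun y h => wirtinger_ddbar_discPotential (v := v) h.1 h.2 u u
  have hT := hasWirtingerAt_discDefect (v := v) hd u
  have he := (hasWirtingerAt_ofReal hd u).rexp
  have hvx := HasWirtingerAt.clm v x u
  have hθ := hasWirtingerAt_connForm (v := v) hΦ2 u u
  have hΦ1 := hasWirtingerAt_wirtinger_ofReal hΦ2 u u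
  have hp := (he.mul hvx.conj).mul hθ
  have h2 := HasWirtingerAt.const 2 x u
  have hA := ((hΦ1.mul hθ).add (((HasWirtingerAt.const (v u) x u).mul hΦ1).add (hvx.mul hΦuu))).add
    (((h2.mul hθ).mul hp).div hT hne)
  have hT2 := hT.mul hT
  have hH := ((hg1.div hT hne).add (((h2.mul hp).mul hg).div hT2 (mul_ne_zero hne hne))).add
    (((hA.mul he).mul hθ.conj).div hT2 (mul_ne_zero hne hne))
  rw [ddbar_eq_wirtingerBar_wirtinger (hK.ddbar (by norm_num) u u), 
    Filter.EventuallyEq.wirtingerBar_eq hev]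
  simp only [pow_two, discShear]
  refine (show _ = _ from hH.bar).trans ?_
  have hv : v u = connForm v Φ x u - v x * wirtinger (fun z => (Φ z : ℂ)) x u := by
    simp [connForm]
  have hTe := discDefect_eq v Φ x
  simp only [T] at hne
  simp only [g, g', Q, T, e, θ, A, p, discShear, hv, map_add, map_mul, map_sub, map_div₀, map_ofNat,
    Complex.conj_conj, Complex.conj_ofReal]
  clear_value g g' Q T e θ A p
  clear * - hne hTe
  -- From here on the derivatives and their conjugates are independent symbols. The claim is a
  -- rational identity modulo `τ = 1 - v v̄ e^Φ`.
  generalize ddbar (fun y => (Φ y : ℂ)) x u u = g at *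
  generalize wirtinger (fun y => ddbar (fun y => (Φ y : ℂ)) y u u) x u = g' at *
  generalize (discDefect v Φ x : ℂ) = T at *
  generalize (Real.exp (Φ x) : ℂ) = e at *
  generalize connForm v Φ x u = θ at *
  generalize wirtinger (fun z => (Φ z : ℂ)) x u = a at *
  generalize wirtinger (fun y => wirtinger (fun z => (Φ z : ℂ)) y u) x u = b at *
  generalize v x = w at *
  generalize (starRingEnd ℂ) w = w' at *
  generalize (starRingEnd ℂ) a = a' at *
  generalize (starRingEnd ℂ) b = b' at *
  generalize (starRingEnd ℂ) θ = θ' at *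
  generalize (starRingEnd ℂ) g' = g'' at *
  field_simp
  rw [hTe]
  ring

end DiscCurvature

/-! ### The curvature of the disc metric from its potential. -/

section DiscCurvatureQuartic

variable {E : Type*} [NormedAddCommGroup E] [NormedSpace ℂ E]
  {v : E →L[ℂ] ℂ} {Φ : E → ℝ} {x : E}

theorem connForm_add (v : E →L[ℂ] ℂ) (Φ : E → ℝ) (x u w : E) :
    connForm v Φ x (u + w) = connForm v Φ x u + connForm v Φ x w := by
  simp only [connForm, wirtinger_add_right, map_add]; ring

theorem connForm_smul (v : E →L[ℂ] ℂ) (Φ : E → ℝ) (x : E) (c : ℂ) (u : E) :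
    connForm v Φ x (c • u) = c * connForm v Φ x u := by
  simp only [connForm, wirtinger_smul_right, map_smul, smul_eq_mul]; ring

theorem ddbar_add_right_ofReal (hΦ : ContDiffAt ℝ 2 (fun y => (Φ y : ℂ)) x) (u a b : E) :
    ddbar (fun y => (Φ y : ℂ)) x u (a + b) =
      ddbar (fun y => (Φ y : ℂ)) x u a + ddbar (fun y => (Φ y : ℂ)) x u b := by
  simp only [← conj_ddbar_ofReal hΦ _ u, ddbar_add_left, map_add]

theorem ddbar_smul_right_ofReal (hΦ : ContDiffAt ℝ 2 (fun y => (Φ y : ℂ)) x) (c : ℂ) (u a : E) :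
    ddbar (fun y => (Φ y : ℂ)) x u (c • a) =
      (starRingEnd ℂ) c * ddbar (fun y => (Φ y : ℂ)) x u a := by
  simp only [← conj_ddbar_ofReal hΦ _ u, ddbar_smul_left, map_mul]

theorem wirtinger_ddbar_add_right_ofReal (hΦ : ContDiffAt ℝ 3 (fun y => (Φ y : ℂ)) x)
    (c u a b : E) : wirtinger (fun y => ddbar (fun y => (Φ y : ℂ)) y u (a + b)) x c =
      wirtinger (fun y => ddbar (fun y => (Φ y : ℂ)) y u a) x c
        + wirtinger (fun y => ddbar (fun y => (Φ y : ℂ)) y u b) x c := by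
  have hd : ∀ b, DifferentiableAt ℝ (fun y => ddbar (fun y => (Φ y : ℂ)) y u b) x := fun b =>
    (hΦ.ddbar (m := 1) (by norm_num) u b).differentiableAt (by norm_num)
  rw [← ((HasWirtingerAt.of_differentiableAt (hd a) c).add
    (HasWirtingerAt.of_differentiableAt (hd b) c)).wirt]
  refine Filter.EventuallyEq.wirtinger_eq ?_ c
  filter_upwards [hΦ.eventually (by norm_num)] with y hy
  exact ddbar_add_right_ofReal (hy.of_le (by norm_num)) u a b

theorem wirtinger_ddbar_smul_right_ofReal (hΦ : ContDiffAt ℝ 3 (fun y => (Φ y : ℂ)) x)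
    (c u : E) (k : ℂ) (a : E) : wirtinger (fun y => ddbar (fun y => (Φ y : ℂ)) y u (k • a)) x c =
      (starRingEnd ℂ) k * wirtinger (fun y => ddbar (fun y => (Φ y : ℂ)) y u a) x c := by
  have hd : DifferentiableAt ℝ (fun y => ddbar (fun y => (Φ y : ℂ)) y u a) x :=
    (hΦ.ddbar (m := 1) (by norm_num) u a).differentiableAt (by norm_num)
  have := ((HasWirtingerAt.const ((starRingEnd ℂ) k) x c).mul
    (HasWirtingerAt.of_differentiableAt hd c)).wirt
  rw [zero_mul, zero_add] at this
  rw [← this]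
  refine Filter.EventuallyEq.wirtinger_eq ?_ c
  filter_upwards [hΦ.eventually (by norm_num)] with y hy
  exact ddbar_smul_right_ofReal (hy.of_le (by norm_num)) k u a

/-- The form `∂∂̄Φ` is degenerate along the fibre, and the vertical vector `f` has `θ(f) = 1`. So
the base part and the `θ` part of a vector can be prescribed separately, and `curvatureQuartic_eq`
applies. -/
theorem curvatureQuartic_discPotential [FiniteDimensional ℂ E] {G : E → E → E → ℂ}
    (hΦ : ContDiffAt ℝ 4 (fun y => (Φ y : ℂ)) x) (hτ : 0 < discDefect v Φ x)
    (hG : ∀ᶠ y in nhds x, ∀ a b, G y a b = ddbar (fun y => (discPotential v Φ y : ℂ)) y a b)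
    (hherm : IsHermitianInner (G x)) {u wM f : E}
    (hwM : ∀ b, wirtinger (fun y => ddbar (fun y => (Φ y : ℂ)) y u b) x u =
      ddbar (fun y => (Φ y : ℂ)) x wM b)
    (hvf : v f = 1) (hf : wirtinger (fun y => (Φ y : ℂ)) x f = 0)
    (hff : ∀ b, ddbar (fun y => (Φ y : ℂ)) x f b = 0) :
    curvatureQuartic G x u =
      (ddbar (fun y => (Φ y : ℂ)) x wM wM
        - ddbar (fun y => ddbar (fun y => (Φ y : ℂ)) y u u) x u u) / discDefect v Φ x
      + 2 * ddbar (fun y => (Φ y : ℂ)) x u u ^ 2 / discDefect v Φ x - 2 * G x u u ^ 2 := by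
  have hΦ3 : ContDiffAt ℝ 3 (fun y => (Φ y : ℂ)) x := hΦ.of_le (by norm_num)
  have hΦ2 : ContDiffAt ℝ 2 (fun y => (Φ y : ℂ)) x := hΦ.of_le (by norm_num)
  have hne : (discDefect v Φ x : ℂ) ≠ 0 := by exact_mod_cast hτ.ne'
  have hθf : connForm v Φ x f = 1 := by simp [connForm, hvf, hf]
  set p : ℂ := Real.exp (Φ x) * (starRingEnd ℂ) (v x) * connForm v Φ x u with hp
  set k : ℂ := 2 * p / discDefect v Φ x with hk
  -- The multiple `k` of `u` matches the base part of `∂_u G(u, ·)`. The coefficient of `f` then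
  -- adjusts `θ(w)` to `discShear` without affecting the base part.
  set w : E := wM + k • u
    + (discShear v Φ x u - connForm v Φ x wM - k * connForm v Φ x u) • f with hw
  have hθw : connForm v Φ x w = discShear v Φ x u := by
    simp only [hw, connForm_add, connForm_smul, hθf]; ring
  have hgw : ∀ b, ddbar (fun y => (Φ y : ℂ)) x w b =
      ddbar (fun y => (Φ y : ℂ)) x wM b + k * ddbar (fun y => (Φ y : ℂ)) x u b := fun b => by
    simp only [hw, ddbar_add_left, ddbar_smul_left, hff]; ring
  have hGx : ∀ a b, G x a b = ddbar (fun y => (Φ y : ℂ)) x a b / discDefect v Φ x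
      + Real.exp (Φ x) * connForm v Φ x a * (starRingEnd ℂ) (connForm v Φ x b)
        / discDefect v Φ x ^ 2 := fun a b => by
    rw [hG.self_of_nhds, ddbar_discPotential hΦ2 hτ]
  have hGw : ∀ b, wirtinger (fun y => G y u b) x u = G x w b := fun b => by
    rw [Filter.EventuallyEq.wirtinger_eq (hG.mono fun y hy => hy u b),
      wirtinger_ddbar_discPotential hΦ3 hτ, hGx, hθw, hgw, hwM, ← hp, hk]
    field_simp
  have hfar : ∀ a, ddbar (fun y => (Φ y : ℂ)) x a f = 0 := fun a => by
    rw [← conj_ddbar_ofReal hΦ2, hff, map_zero]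
  have hgww : ddbar (fun y => (Φ y : ℂ)) x w w = ddbar (fun y => (Φ y : ℂ)) x wM wM
      + (starRingEnd ℂ) k * ddbar (fun y => (Φ y : ℂ)) x wM u
      + k * (starRingEnd ℂ) (ddbar (fun y => (Φ y : ℂ)) x wM u)
      + k * (starRingEnd ℂ) k * ddbar (fun y => (Φ y : ℂ)) x u u := by
    rw [hgw, hw]
    simp only [ddbar_add_right_ofReal hΦ2, ddbar_smul_right_ofReal hΦ2, hfar]
    rw [conj_ddbar_ofReal hΦ2]
    ring
  rw [curvatureQuartic_eq hherm hGw, Filter.EventuallyEq.ddbar_eq (hG.mono fun y hy => hy u u),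
    wirtingerBar_wirtinger_ddbar_discPotential hΦ hτ u, hGx, hGx, hθw, hgww, hwM, ← hp, hk]
  simp only [map_mul, map_div₀, Complex.conj_ofReal, map_ofNat]
  field_simp
  ring

end DiscCurvatureQuartic

/-! ### The model `E × Hom(ℂ, ℂ)` with a potential from the base. -/

section DiscBundleModel

variable {E : Type*} [NormedAddCommGroup E] [NormedSpace ℂ E] {φ : E → ℝ}

/-- The linear coordinate on the fibre of the model `E × Hom(ℂ, ℂ)` of the dual line bundle. -/
noncomputable def fiberCoord (E : Type*) [NormedAddCommGroup E] [NormedSpace ℂ E] :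
    E × (ℂ →L[ℂ] ℂ) →L[ℂ] ℂ :=
  (ContinuousLinearMap.apply ℂ ℂ (1 : ℂ)).comp (ContinuousLinearMap.snd ℂ E (ℂ →L[ℂ] ℂ))

theorem fiberCoord_apply (y : E × (ℂ →L[ℂ] ℂ)) : fiberCoord E y = y.2 1 := rfl

variable {y : E × (ℂ →L[ℂ] ℂ)}

theorem wirtinger_comp_fst {F : E → ℂ} (hF : DifferentiableAt ℝ F y.1) (u : E × (ℂ →L[ℂ] ℂ)) :
    wirtinger (fun z : E × (ℂ →L[ℂ] ℂ) => F z.1) y u = wirtinger F y.1 u.1 := by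
  rw [wirtinger_comp (φ := Prod.fst) hF differentiableAt_fst, fderiv_fst]
  rfl

theorem ddbar_comp_fst {F : E → ℂ} (hF : ContDiffAt ℝ 2 F y.1) (u w : E × (ℂ →L[ℂ] ℂ)) :
    ddbar (fun z : E × (ℂ →L[ℂ] ℂ) => F z.1) y u w = ddbar F y.1 u.1 w.1 := by
  rw [ddbar_comp (φ := Prod.fst) hF contDiffAt_fst, fderiv_fst]
  rfl

theorem contDiffAt_comp_fst {n : WithTop ℕ∞} {F : Type*} [NormedAddCommGroup F] [NormedSpace ℝ F]
    {f : E → F} (hf : ContDiffAt ℝ n f y.1) :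
    ContDiffAt ℝ n (fun z : E × (ℂ →L[ℂ] ℂ) => f z.1) y :=
  hf.comp y contDiffAt_fst

/-- Both summands of `g / τ + e^Φ θ θ̄ / τ²` are nonnegative. The first vanishes only on vertical
vectors, where `θ` is the fibre coordinate. -/
theorem isHermitianInner_ddbar_discPotential (hφ : ContDiffAt ℝ 2 φ y.1)
    (hg : IsHermitianInner (ddbar (fun z => (φ z : ℂ)) y.1))
    (hτ : 0 < discDefect (fiberCoord E) (fun z => φ z.1) y) :
    IsHermitianInner
      (ddbar (fun z => (discPotential (fiberCoord E) (fun z => φ z.1) z : ℂ)) y) := by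
  have hΦ : ContDiffAt ℝ 2 (fun z : E × (ℂ →L[ℂ] ℂ) => φ z.1) y := contDiffAt_comp_fst hφ
  refine ⟨fun _ _ _ => ddbar_add_left _ _ _ _ _, fun _ _ _ => ddbar_smul_left _ _ _ _ _,
    fun _ _ => (conj_ddbar_ofReal (contDiffAt_discPotential hΦ hτ).ofReal _ _).symm, fun u hu => ?_⟩
  rw [ddbar_discPotential hΦ.ofReal hτ, ddbar_comp_fst (F := fun z => (φ z : ℂ)) hφ.ofReal,
    mul_assoc, Complex.mul_conj, ← hg.ofReal_re_self]
  norm_cast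
  have h1 := hg.nonneg u.1
  by_cases h0 : u.1 = 0
  · have hθ : connForm (fiberCoord E) (fun z => φ z.1) y u ≠ 0 := by
      simp only [connForm]
      rw [wirtinger_comp_fst (F := fun z => (φ z : ℂ)) (hφ.ofReal.differentiableAt (by norm_num)),
        h0, ← zero_smul ℂ (0 : E), wirtinger_smul_right]
      simp only [zero_mul, mul_zero, add_zero, fiberCoord_apply]
      intro h2
      refine hu (Prod.ext h0 (ContinuousLinearMap.ext_ring h2))
    have := Complex.normSq_pos.2 hθ
    positivity
  · have := hg.pos u.1 h0
    have := Complex.normSq_nonneg (connForm (fiberCoord E) (fun z => φ z.1) y u)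
    positivity

/-- Division of `R_D = (R_M + 2 g²) / τ - 2 G²` by `G²`, in arbitrary product coordinates. -/
theorem holSectCurvCoord_disc [FiniteDimensional ℂ E] {g : E → E → E → ℂ}
    {G : (E × (ℂ →L[ℂ] ℂ)) → (E × (ℂ →L[ℂ] ℂ)) → (E × (ℂ →L[ℂ] ℂ)) → ℂ}
    (hφ : ContDiffAt ℝ 4 φ y.1)
    (hg : ∀ᶠ z in nhds y.1, ∀ a b, g z a b = ddbar (fun z => (φ z : ℂ)) z a b)
    (hherm : IsHermitianInner (g y.1))
    (hτ : 0 < discDefect (fiberCoord E) (fun z => φ z.1) y)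
    (hG : ∀ᶠ z in nhds y, ∀ a b, G z a b =
      ddbar (fun z => (discPotential (fiberCoord E) (fun z => φ z.1) z : ℂ)) z a b)
    {u : E × (ℂ →L[ℂ] ℂ)} (hu : u ≠ 0) :
    holSectCurvCoord G y u = -2 * ((G y u u).re ^ 2 - (g y.1 u.1 u.1).re ^ 2
      / discDefect (fiberCoord E) (fun z => φ z.1) y
        * (1 + 1 / 2 * holSectCurvCoord g y.1 u.1)) / (G y u u).re ^ 2 := by
  have hΦ : ContDiffAt ℝ 4 (fun z : E × (ℂ →L[ℂ] ℂ) => φ z.1) y := contDiffAt_comp_fst hφ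
  have hφ2 : ContDiffAt ℝ 2 φ y.1 := hφ.of_le (by norm_num)
  have hgy : g y.1 = ddbar (fun z => (φ z : ℂ)) y.1 :=
    funext fun a => funext fun b => hg.self_of_nhds a b
  have hGy : G y = ddbar (fun z => (discPotential (fiberCoord E) (fun z => φ z.1) z : ℂ)) y :=
    funext fun a => funext fun b => hG.self_of_nhds a b
  have hGh : IsHermitianInner (G y) := by
    rw [hGy]
    exact isHermitianInner_ddbar_discPotential hφ2 (hgy ▸ hherm) hτ
  have hφ3 : ContDiffAt ℝ 3 (fun z => (φ z : ℂ)) y.1 := (hφ.of_le (by norm_num)).ofReal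
  have hwg : ∀ b, wirtinger (fun z => g z u.1 b) y.1 u.1 =
      wirtinger (fun z => ddbar (fun z => (φ z : ℂ)) z u.1 b) y.1 u.1 := fun b =>
    Filter.EventuallyEq.wirtinger_eq (hg.mono fun z hz => hz u.1 b) _
  obtain ⟨wM, hwM⟩ := hherm.exists_eq_of_conj_linear
    (fun b => wirtinger (fun z => g z u.1 b) y.1 u.1)
    (fun a b => by simp only [hwg, wirtinger_ddbar_add_right_ofReal hφ3])
    (fun c b => by simp only [hwg, wirtinger_ddbar_smul_right_ofReal hφ3])
  have hquart := curvatureQuartic_eq hherm hwM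
  have hdd : ∀ b, (fun z => ddbar (fun z : E × (ℂ →L[ℂ] ℂ) => (φ z.1 : ℂ)) z u b) =ᶠ[nhds y]
      fun z => ddbar (fun z => (φ z : ℂ)) z.1 u.1 b.1 := fun b => by
    filter_upwards [continuousAt_fst.eventually (hφ2.eventually (by norm_num))] with z hz
    exact ddbar_comp_fst (F := fun z => (φ z : ℂ)) hz.ofReal u b
  have hdc : ∀ b, ContDiffAt ℝ 2 (fun z => ddbar (fun z => (φ z : ℂ)) z u.1 b) y.1 := fun b =>
    hφ.ofReal.ddbar (by norm_num) _ _
  have hQ : ddbar (fun z => ddbar (fun z : E × (ℂ →L[ℂ] ℂ) => (φ z.1 : ℂ)) z u u) y u u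
      = ddbar (fun z => g z u.1 u.1) y.1 u.1 u.1 := by
    rw [(hdd u).ddbar_eq, ddbar_comp_fst (F := fun z => ddbar (fun z => (φ z : ℂ)) z u.1 u.1) (hdc _)]
    exact (Filter.EventuallyEq.ddbar_eq (hg.mono fun z hz => hz u.1 u.1) _ _).symm
  have hfst : ∀ a b, ddbar (fun z : E × (ℂ →L[ℂ] ℂ) => (φ z.1 : ℂ)) y a b = g y.1 a.1 b.1 :=
    fun a b => by
      rw [ddbar_comp_fst (F := fun z => (φ z : ℂ)) hφ2.ofReal, hgy]
  -- Any lift of the base vector would do; the zero fibre component is chosen. The identity of `ℂ`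
  -- is the vertical vector with fibre coordinate one.
  have hGq := curvatureQuartic_discPotential (v := fiberCoord E) (u := u) (wM := (wM, 0))
    (f := (0, ContinuousLinearMap.id ℂ ℂ)) hΦ.ofReal hτ hG hGh
    (fun b => by
      rw [(hdd b).wirtinger_eq, wirtinger_comp_fst
        (F := fun z => ddbar (fun z => (φ z : ℂ)) z u.1 b.1)
          ((hdc _).differentiableAt (by norm_num)), ← hwg, hwM, hfst])
    rfl
    (by
      rw [wirtinger_comp_fst (F := fun z => (φ z : ℂ))
        (hφ2.ofReal.differentiableAt (by norm_num)), ← zero_smul ℂ (0 : E), wirtinger_smul_right,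
        zero_mul])
    (fun b => by rw [hfst, hherm.zero_left])
  rw [hQ, hfst, hfst] at hGq
  simp only [holSectCurvCoord]
  have hre : (curvatureQuartic G y u).re = ((curvatureQuartic g y.1 u.1).re
      + 2 * (g y.1 u.1 u.1).re ^ 2) / discDefect (fiberCoord E) (fun z => φ z.1) y
      - 2 * (G y u u).re ^ 2 := by
    rw [hGq, hquart, ← hherm.ofReal_re_self u.1, ← hGh.ofReal_re_self u, ← add_div]
    simp only [Complex.sub_re, Complex.div_ofReal_re, Complex.add_re]
    norm_cast
  -- For vertical `u` the base curvature is `0 / 0`, which is `0` by convention. Cancelling `g²` is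
  -- then impossible, so the vanishing of the base quartic is needed separately.
  have hR0 : u.1 = 0 → (curvatureQuartic g y.1 u.1).re = 0 := fun h0 => by
    have hw0 : wM = 0 := by
      refine hherm.eq_zero_of_self _ ?_
      rw [← hwM, h0, ← zero_smul ℂ (0 : E), wirtinger_smul_right, zero_mul]
    rw [hquart, hw0, hherm.zero_left, h0]
    have : ddbar (fun z => g z 0 0) y.1 0 0 = 0 := by
      conv_lhs => enter [3]; rw [← zero_smul ℂ (0 : E)]
      rw [ddbar_smul_left, zero_mul]
    simp [this]
  have hGu := hGh.pos u hu
  rw [hre]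
  by_cases h0 : u.1 = 0
  · rw [hR0 h0, h0, hherm.zero_left]
    simp only [Complex.zero_re]
    field_simp
    ring
  · have := hherm.pos u.1 h0
    field_simp
    ring

end DiscBundleModel

/-! ### Forms on a manifold in holomorphic parameters. -/

section ManifoldForms

variable {E : Type*} [NormedAddCommGroup E] [NormedSpace ℂ E]
  {H : Type*} [TopologicalSpace H] {I : ModelWithCorners ℂ E H} [I.Boundaryless]
  {N : Type*} [TopologicalSpace N] [ChartedSpace H N]
  {E' : Type*} [NormedAddCommGroup E'] [NormedSpace ℂ E']

theorem FormField.congr_point (g : FormField I N) {p q : N} (h : q = p) (a b : E) :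
    g q a b = g p a b := by
  subst h; rfl

theorem mfderiv_eq_fderiv_extChartAt_comp {ψ : E' → N} {y : E'}
    (hψ : MDifferentiableAt 𝓘(ℂ, E') I ψ y) :
    (mfderiv 𝓘(ℂ, E') I ψ y : E' →L[ℂ] E) = fderiv ℂ (fun z => extChartAt I (ψ y) (ψ z)) y := by
  rw [hψ.mfderiv]
  simp only [mfld_simps, fderivWithin_univ]
  rfl

theorem contDiffAt_extChartAt_comp {n : WithTop ℕ∞} {ψ : E' → N} {y : E'}
    (hψ : ContMDiffAt 𝓘(ℂ, E') I n ψ y) :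
    ContDiffAt ℂ n (fun z => extChartAt I (ψ y) (ψ z)) y :=
  (contMDiffAt_iff_target.1 hψ).2.contDiffAt

theorem eventually_extChartAt_symm_comp {ψ : E' → N} {y : E'} (hψ : ContinuousAt ψ y) :
    ∀ᶠ z in nhds y, (extChartAt I (ψ y)).symm (extChartAt I (ψ y) (ψ z)) = ψ z := by
  filter_upwards [hψ.eventually (extChartAt_source_mem_nhds (I := I) (ψ y))] with z hz
  exact (extChartAt I (ψ y)).left_inv hz

/-- `∂∂̄ f` in arbitrary holomorphic parameters. -/
theorem coeffs_leviForm {f : N → ℝ} {ψ : E' → N} {y : E'}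
    (hψ : ContMDiffAt 𝓘(ℂ, E') I 2 ψ y)
    (hf : ContDiffAt ℝ 2 (f ∘ (extChartAt I (ψ y)).symm) (extChartAt I (ψ y) (ψ y))) (a b : E') :
    coeffs I (leviForm I f) ψ y a b = ddbar (fun z => (f (ψ z) : ℂ)) y a b := by
  have h1 : (fun z => (f (ψ z) : ℂ)) =ᶠ[nhds y]
      fun z => (f ((extChartAt I (ψ y)).symm (extChartAt I (ψ y) (ψ z))) : ℂ) := by
    filter_upwards [eventually_extChartAt_symm_comp (I := I) hψ.continuousAt] with z hz
    rw [hz]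
  rw [h1.ddbar_eq]
  have h2 := ddbar_comp (F := fun w => (f ((extChartAt I (ψ y)).symm w) : ℂ))
    (φ := fun z => extChartAt I (ψ y) (ψ z)) (y := y) hf.ofReal (contDiffAt_extChartAt_comp hψ) a b
  rw [h2, ← mfderiv_eq_fderiv_extChartAt_comp (hψ.mdifferentiableAt (by norm_num))]
  rfl

variable [IsManifold I ω N]

theorem contMDiffAt_extChartAt_symm {p : N} {y : E} (hy : y ∈ (extChartAt I p).target) :
    ContMDiffAt 𝓘(ℂ, E) I ω (extChartAt I p).symm y :=
  (contMDiffOn_extChartAt_symm p).contMDiffAt ((isOpen_extChartAt_target p).mem_nhds hy)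

/-- The tangent space at `p` is identified with `E` by the preferred chart at `p`, so the inverse
chart has identity derivative at its centre, though not at other points. -/
theorem coeffs_extChartAt_symm_self (g : FormField I N) (p : N) (a b : E) :
    coeffs I g (extChartAt I p).symm (extChartAt I p p) a b = g p a b := by
  have h0 := extChartAt_to_inv (I := I) p
  have hm : (mfderiv 𝓘(ℂ, E) I (extChartAt I p).symm (extChartAt I p p) : E →L[ℂ] E)
      = ContinuousLinearMap.id ℂ E := by
    rw [mfderiv_eq_fderiv_extChartAt_comp ((contMDiffAt_extChartAt_symm
      (mem_extChartAt_target p)).mdifferentiableAt (by norm_num)), h0]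
    have : (fun z => extChartAt I p ((extChartAt I p).symm z)) =ᶠ[nhds (extChartAt I p p)] id := by
      filter_upwards [extChartAt_target_mem_nhds (I := I) p] with z hz
      exact (extChartAt I p).right_inv hz
    rw [this.fderiv_eq, fderiv_id]
  have h1 : coeffs I g (extChartAt I p).symm (extChartAt I p p) a b
      = g ((extChartAt I p).symm (extChartAt I p p)) a b := by
    unfold coeffs
    have := fun c : E => congrArg (fun L : E →L[ℂ] E => L c) hm
    exact congrArg₂ (g ((extChartAt I p).symm (extChartAt I p p))) (this a) (this b)
  rw [h1, g.congr_point h0]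

/-- Change of holomorphic parameters. -/
theorem coeffs_comp (g : FormField I N) {F : Type*} [NormedAddCommGroup F] [NormedSpace ℂ F]
    {ψ : E' → N} {τ : F → E'} {y : F} (hψ : MDifferentiableAt 𝓘(ℂ, E') I ψ (τ y))
    (hτ : DifferentiableAt ℂ τ y) (a b : F) :
    coeffs I g (fun z => ψ (τ z)) y a b =
      coeffs I g ψ (τ y) (fderiv ℂ τ y a) (fderiv ℂ τ y b) := by
  have h : mfderiv 𝓘(ℂ, F) I (fun z => ψ (τ z)) y = _ :=
    mfderiv_comp (I' := 𝓘(ℂ, E')) y hψ hτ.mdifferentiableAt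
  unfold coeffs
  rw [h, mfderiv_eq_fderiv]
  rfl

theorem coeffs_congr (g : FormField I N) {ψ ψ' : E' → N} {y : E'} (h : ψ =ᶠ[nhds y] ψ')
    (a b : E') : coeffs I g ψ y a b = coeffs I g ψ' y a b := by
  unfold coeffs
  rw [h.mfderiv_eq]
  exact g.congr_point h.self_of_nhds _ _

end ManifoldForms

/-! ### Pluriharmonicity of `log |c|²`. -/

section Pluriharmonic

variable {E : Type*} [NormedAddCommGroup E] [NormedSpace ℂ E]

theorem ddbar_add {F G : E → ℂ} {x : E} (hF : ContDiffAt ℝ 2 F x) (hG : ContDiffAt ℝ 2 G x)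
    (u v : E) : ddbar (fun y => F y + G y) x u v = ddbar F x u v + ddbar G x u v := by
  have h : ∀ {F : E → ℂ}, ContDiffAt ℝ 2 F x →
      HasWirtingerAt (fun y => wirtingerBar F y v) x u (ddbar F x u v) _ := fun hF =>
    HasWirtingerAt.of_differentiableAt
      ((hF.wirtingerBar (m := 1) (by norm_num) v).differentiableAt (by norm_num)) u
  rw [← ((h hF).add (h hG)).wirt]
  refine Filter.EventuallyEq.wirtinger_eq ?_ u
  filter_upwards [hF.eventually (by norm_num), hG.eventually (by norm_num)] with y h1 h2
  exact ((HasWirtingerAt.of_differentiableAt (h1.differentiableAt (by norm_num)) v).add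
    (HasWirtingerAt.of_differentiableAt (h2.differentiableAt (by norm_num)) v)).bar

theorem ddbar_neg (F : E → ℂ) (x u v : E) :
    ddbar (fun y => -F y) x u v = -ddbar F x u v := by
  have h1 : ∀ y w, wirtingerBar (fun y => -F y) y w = -wirtingerBar F y w := fun y w => by
    simp only [wirtingerBar, fderiv_fun_neg, neg_apply]; ring
  simp only [ddbar, h1]
  simp only [wirtinger, fderiv_fun_neg, neg_apply]; ring

/-- `log |c|²` is pluriharmonic for holomorphic `c ≠ 0`. -/
theorem ddbar_log_norm_sq {c : E → ℂ} {x : E} (hc : ContDiffAt ℂ 2 c x) (h0 : c x ≠ 0) (u v : E) :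
    ddbar (fun y => (Real.log (‖c y‖ ^ 2) : ℂ)) x u v = 0 := by
  have hcd : ∀ᶠ y in nhds x, DifferentiableAt ℂ c y ∧ c y ≠ 0 :=
    ((hc.eventually (by norm_num)).mono fun y hy => hy.differentiableAt (by norm_num)).and
      (hc.continuousAt.eventually_ne h0)
  -- `∂̄ log |c|²` is the conjugate of the holomorphic `∂c / c`, hence annihilated by `∂`.
  have h1 : (fun y => wirtingerBar (fun y => (Real.log (‖c y‖ ^ 2) : ℂ)) y v) =ᶠ[nhds x]
      fun y => (starRingEnd ℂ) (fderiv ℂ c y v / c y) := by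
    filter_upwards [hcd] with y ⟨hy, hy0⟩
    have hh := HasWirtingerAt.of_holomorphic hy v
    have h2 : HasWirtingerAt (fun y => ((‖c y‖ ^ 2 : ℝ) : ℂ)) y v _ _ :=
      (hh.mul hh.conj).congr_of_eventuallyEq (.of_forall fun z => by
        simp [Complex.mul_conj, Complex.normSq_eq_norm_sq])
    rw [(h2.log (by positivity)).bar]
    have : (starRingEnd ℂ) (c y) ≠ 0 := by simpa using hy0
    have h3 : ((‖c y‖ ^ 2 : ℝ) : ℂ) = c y * (starRingEnd ℂ) (c y) := by
      simp [Complex.mul_conj, Complex.normSq_eq_norm_sq]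
    rw [h3, map_div₀]
    field_simp
    ring
  have h4 : DifferentiableAt ℂ (fun y => fderiv ℂ c y v / c y) x := by
    simp only [div_eq_mul_inv]
    exact
    ((((hc.fderiv_right (m := 1) (by norm_num)).differentiableAt (by norm_num)).clm_apply
      (differentiableAt_const v)).mul ((hc.differentiableAt (by norm_num)).inv h0))
  rw [ddbar, h1.wirtinger_eq, wirtinger_conj, (HasWirtingerAt.of_holomorphic h4 u).bar, map_zero]

end Pluriharmonic

/-! ### Local frames and the curvature form. -/

section Frames

variable {E : Type*} [NormedAddCommGroup E] [NormedSpace ℂ E]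
  {M : Type*} [TopologicalSpace M] [ChartedSpace E M]
  {L : M → Type*} [∀ x, AddCommGroup (L x)] [∀ x, Module ℂ (L x)] [∀ x, TopologicalSpace (L x)]
  [TopologicalSpace (TotalSpace ℂ L)] [FiberBundle ℂ L] [VectorBundle ℂ ℂ L]

theorem eq_smul_localFrame {p x : M} (hx : x ∈ (trivializationAt ℂ L p).baseSet) (s : L x) :
    s = (trivializationAt ℂ L p ⟨x, s⟩).2 • localFrame L p x := by
  have h := (trivializationAt ℂ L p).symm_apply_apply_mk hx s
  conv_lhs => rw [← h]
  have h1 := map_smul ((trivializationAt ℂ L p).symmₗ ℂ x)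
    (trivializationAt ℂ L p ⟨x, s⟩).2 (1 : ℂ)
  have h2 := fun c => (trivializationAt ℂ L p).symmₗ_apply (R := ℂ) hx c
  rw [smul_eq_mul, mul_one, h2, h2] at h1
  exact h1

theorem localFrame_ne_zero {p x : M} (hx : x ∈ (trivializationAt ℂ L p).baseSet) :
    localFrame L p x ≠ 0 := by
  intro h
  have h1 := (trivializationAt ℂ L p).apply_mk_symm hx (1 : ℂ)
  have h2 := (trivializationAt ℂ L p).zeroSection ℂ hx
  rw [localFrame] at h
  rw [h] at h1
  have := congrArg Prod.snd (h1.symm.trans h2)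
  exact one_ne_zero this

namespace HermitianLineMetric

variable (h : HermitianLineMetric 𝓘(ℂ, E) L)

theorem normSq_smul {x : M} (c : ℂ) (s : L x) : h.normSq (c • s) = ‖c‖ ^ 2 * h.normSq s := by
  unfold normSq
  rw [(h.hermitian x).smul_left, (h.hermitian x).smul_right, ← mul_assoc, Complex.mul_conj,
    Complex.re_ofReal_mul, Complex.normSq_eq_norm_sq]

theorem normSq_pos {x : M} {s : L x} (hs : s ≠ 0) : 0 < h.normSq s := (h.hermitian x).pos s hs

theorem normSq_localFrame_pos {p x : M} (hx : x ∈ (trivializationAt ℂ L p).baseSet) :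
    0 < h.normSq (localFrame L p x) := h.normSq_pos (localFrame_ne_zero hx)

/-- Replacing `s` by `c s` multiplies numerator and denominator by `|c|²`. -/
theorem dualNormSq_eq (η : DualTotal L) {s : L η.1} (hs : s ≠ 0) :
    h.dualNormSq η = ‖(η.2 s : ℂ)‖ ^ 2 / h.normSq s := by
  have hx := FiberBundle.mem_baseSet_trivializationAt' (F := ℂ) (E := L) η.1
  have h1 := eq_smul_localFrame hx s
  have hp := h.normSq_localFrame_pos hx
  set c := (trivializationAt ℂ L η.1 ⟨η.1, s⟩).2
  have hc : c ≠ 0 := fun h0 => hs (by rw [h1, h0, zero_smul])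
  have hη : (η.2 s : ℂ) = c * (η.2 (localFrame L η.1 η.1) : ℂ) := by
    conv_lhs => rw [h1]
    exact map_smul η.2 c _
  have hn : h.normSq s = ‖c‖ ^ 2 * h.normSq (localFrame L η.1 η.1) := by
    conv_lhs => rw [h1]
    exact h.normSq_smul _ _
  have : ‖c‖ ≠ 0 := by simpa using hc
  rw [hη, hn, dualNormSq, norm_mul, mul_pow, mul_div_mul_left _ _ (by positivity)]

/-- The local Kähler potential `-log |s|²` of the curvature form, for the frame at `p` and in the
coordinates at `p`. -/
noncomputable def localPotential (p : M) (z : E) : ℝ :=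
  -Real.log (h.normSq (localFrame L p ((extChartAt 𝓘(ℂ, E) p).symm z)))

theorem contDiffAt_localPotential (p : M) :
    ContDiffAt ℝ ∞ (h.localPotential p) (extChartAt 𝓘(ℂ, E) p p) := by
  refine (ContDiffAt.log (h.smooth p) ?_).neg
  have h0 := extChartAt_to_inv (I := 𝓘(ℂ, E)) p
  simp only [Function.comp_apply]
  rw [h0]
  exact (h.normSq_localFrame_pos (FiberBundle.mem_baseSet_trivializationAt' (F := ℂ) p)).ne'

end HermitianLineMetric

variable [IsManifold 𝓘(ℂ, E) ω M] [ContMDiffVectorBundle ω ℂ L 𝓘(ℂ, E)]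

theorem contMDiffOn_localFrame (p : M) :
    ContMDiffOn 𝓘(ℂ, E) (𝓘(ℂ, E).prod 𝓘(ℂ, ℂ)) ω
      (fun x => TotalSpace.mk' ℂ x (localFrame L p x)) (trivializationAt ℂ L p).baseSet := by
  rw [Trivialization.contMDiffOn_section_baseSet_iff (trivializationAt ℂ L p)]
  refine (contMDiffOn_const (c := (1 : ℂ))).congr fun x hx => ?_
  rw [localFrame, Trivialization.apply_mk_symm _ hx]

/-- The transition function between two local frames is holomorphic. -/
theorem contMDiffAt_localFrame_snd {p q x : M} (hp : x ∈ (trivializationAt ℂ L p).baseSet)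
    (hq : x ∈ (trivializationAt ℂ L q).baseSet) :
    ContMDiffAt 𝓘(ℂ, E) 𝓘(ℂ, ℂ) ω
      (fun x => (trivializationAt ℂ L p ⟨x, localFrame L q x⟩).2) x :=
  ((trivializationAt ℂ L p).contMDiffAt_section_iff hp).1
    ((contMDiffOn_localFrame q).contMDiffAt
      ((trivializationAt ℂ L q).open_baseSet.mem_nhds hq))

variable {E' : Type*} [NormedAddCommGroup E'] [NormedSpace ℂ E']

/-- The curvature form in arbitrary holomorphic parameters. -/
theorem HermitianLineMetric.coeffs_of_eq_curvatureForm (h : HermitianLineMetric 𝓘(ℂ, E) L)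
    {gM : FormField 𝓘(ℂ, E) M}
    (hcurv : ∀ (p : M) (U V : TangentSpace 𝓘(ℂ, E) p), gM p U V = h.curvatureForm p U V)
    {p : M} {ψ : E' → M} {y : E'} (hψ : ContMDiffAt 𝓘(ℂ, E') 𝓘(ℂ, E) ω ψ y)
    (hp : ψ y ∈ (trivializationAt ℂ L p).baseSet)
    (hs : ContDiffAt ℝ 2 (fun z => -Real.log (h.normSq (localFrame L p (ψ z)))) y) (a b : E') :
    coeffs 𝓘(ℂ, E) gM ψ y a b =
      ddbar (fun z => ((-Real.log (h.normSq (localFrame L p (ψ z))) : ℝ) : ℂ)) y a b := by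
  set x := ψ y with hx
  have hxx := FiberBundle.mem_baseSet_trivializationAt' (F := ℂ) (E := L) x
  have h1 : coeffs 𝓘(ℂ, E) gM ψ y a b = -coeffs 𝓘(ℂ, E)
      (leviForm 𝓘(ℂ, E) (fun x' => Real.log (h.normSq (localFrame L x x')))) ψ y a b := by
    unfold coeffs
    rw [hcurv]
    rfl
  have hsm : ContDiffAt ℝ 2 ((fun x' => Real.log (h.normSq (localFrame L x x'))) ∘
      (extChartAt 𝓘(ℂ, E) x).symm) (extChartAt 𝓘(ℂ, E) x x) := by
    have := (h.contDiffAt_localPotential x).neg.of_le (m := 2) (by norm_cast)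
    refine this.congr_of_eventuallyEq (.of_forall fun z => ?_)
    simp [localPotential]
  rw [h1, coeffs_leviForm (hψ.of_le le_top) hsm, ← ddbar_neg]
  -- The curvature form at `x` is defined by the frame centred at `x`, while the potential uses the
  -- fixed frame at `p`. The holomorphic transition function `c` contributes only `log |c|²`.
  set c : E' → ℂ := fun z => (trivializationAt ℂ L p ⟨ψ z, localFrame L x (ψ z)⟩).2 with hc
  have hcs : ContDiffAt ℂ 2 c y :=
    (((contMDiffAt_localFrame_snd hp hxx).comp y hψ).contDiffAt).of_le le_top
  have hc0 : c y ≠ 0 := fun h0 => localFrame_ne_zero hxx (by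
    have := eq_smul_localFrame hp (localFrame L x x)
    rw [this]
    rw [show (trivializationAt ℂ L p ⟨x, localFrame L x x⟩).2 = 0 from h0, zero_smul])
  have hev : (fun z => -(Real.log (h.normSq (localFrame L x (ψ z))) : ℂ)) =ᶠ[nhds y]
      fun z => -(Real.log (‖c z‖ ^ 2) : ℂ)
        + ((-Real.log (h.normSq (localFrame L p (ψ z))) : ℝ) : ℂ) := by
    filter_upwards [hψ.continuousAt.eventually
      ((trivializationAt ℂ L p).open_baseSet.mem_nhds hp),
      hcs.continuousAt.eventually_ne hc0] with z hz hz0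
    have hz' := eq_smul_localFrame hz (localFrame L x (ψ z))
    have h2 : h.normSq (localFrame L x (ψ z)) = ‖c z‖ ^ 2 * h.normSq (localFrame L p (ψ z)) := by
      conv_lhs => rw [hz']
      exact h.normSq_smul _ _
    have h3 := h.normSq_localFrame_pos hz
    rw [h2, Real.log_mul (by positivity) h3.ne']
    push_cast
    ring
  have hlog : ContDiffAt ℝ 2 (fun z => Real.log (‖c z‖ ^ 2)) y :=
    ((hcs.restrict_scalars ℝ).norm_sq ℝ).log (by positivity)
  rw [hev.ddbar_eq, ddbar_add hlog.ofReal.neg hs.ofReal, ddbar_neg, ddbar_log_norm_sq hcs hc0]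
  simp

end Frames

/-! ### Charts of the dual line bundle. -/

section DualBundle

variable {E : Type*} [NormedAddCommGroup E] [NormedSpace ℂ E]
  {M : Type*} [TopologicalSpace M] [ChartedSpace E M]
  {L : M → Type*} [∀ x, AddCommGroup (L x)] [∀ x, Module ℂ (L x)] [∀ x, TopologicalSpace (L x)]
  [TopologicalSpace (TotalSpace ℂ L)] [FiberBundle ℂ L] [VectorBundle ℂ ℂ L]

theorem extChartAt_dual_fst (η ξ : DualTotal L) :
    (extChartAt (dualModel 𝓘(ℂ, E)) η ξ).1 = extChartAt 𝓘(ℂ, E) η.1 ξ.1 := by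
  rw [FiberBundle.extChartAt]
  rfl

/-- The chart of the Hom bundle conjugates `ξ` by the trivializations of `L` and of the trivial
bundle; evaluation at `1` gives its value on the local frame. -/
theorem fiberCoord_extChartAt (η ξ : DualTotal L)
    (hξ : ξ.1 ∈ (trivializationAt ℂ L η.1).baseSet) :
    fiberCoord E (extChartAt (dualModel 𝓘(ℂ, E)) η ξ) = (ξ.2 (localFrame L η.1 ξ.1) : ℂ) := by
  rw [FiberBundle.extChartAt, fiberCoord_apply]
  change (ContinuousLinearMap.inCoordinates ℂ L ℂ (Bundle.Trivial M ℂ) η.1 ξ.1 η.1 ξ.1 ξ.2) 1 = _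
  change ((trivializationAt ℂ (Bundle.Trivial M ℂ) η.1).continuousLinearMapAt ℂ ξ.1)
    (ξ.2 ((trivializationAt ℂ L η.1).symmL ℂ ξ.1 1)) = _
  rw [Trivialization.symmL_apply _ hξ]
  have := Bundle.Trivial.continuousLinearMapAt_trivialization ℂ M ℂ ξ.1
  exact congrArg (fun T : ℂ →L[ℂ] ℂ => T (ξ.2 (localFrame L η.1 ξ.1))) this

theorem mem_target_extChartAt_dual (η : DualTotal L) (w : E × (ℂ →L[ℂ] ℂ)) :
    w ∈ (extChartAt (dualModel 𝓘(ℂ, E)) η).target ↔ w.1 ∈ (extChartAt 𝓘(ℂ, E) η.1).target ∧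
      (extChartAt 𝓘(ℂ, E) η.1).symm w.1 ∈ (trivializationAt ℂ L η.1).baseSet := by
  rw [FiberBundle.extChartAt_target]
  simp

theorem extChartAt_dual_symm_fst (η : DualTotal L) {w : E × (ℂ →L[ℂ] ℂ)}
    (hw : w ∈ (extChartAt (dualModel 𝓘(ℂ, E)) η).target) :
    ((extChartAt (dualModel 𝓘(ℂ, E)) η).symm w).1 = (extChartAt 𝓘(ℂ, E) η.1).symm w.1 := by
  refine FiberBundle.chartedSpace_chartAt_symm_fst η w ?_
  simp only [extChartAt, mfld_simps] at hw
  exact hw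

theorem fiberCoord_of_mem_target (η : DualTotal L) {w : E × (ℂ →L[ℂ] ℂ)}
    (hw : w ∈ (extChartAt (dualModel 𝓘(ℂ, E)) η).target) :
    fiberCoord E w = (((extChartAt (dualModel 𝓘(ℂ, E)) η).symm w).2
      (localFrame L η.1 ((extChartAt (dualModel 𝓘(ℂ, E)) η).symm w).1) : ℂ) := by
  rw [← fiberCoord_extChartAt (E := E), (extChartAt (dualModel 𝓘(ℂ, E)) η).right_inv hw]
  rw [extChartAt_dual_symm_fst η hw]
  exact ((mem_target_extChartAt_dual η w).1 hw).2

variable (h : HermitianLineMetric 𝓘(ℂ, E) L)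

/-- This is `|η|² = |v|² e^φ`, the link between the disc bundle and the model computation. It holds
on the whole chart, as the norm may be computed with the frame at `η.1`. -/
theorem HermitianLineMetric.one_sub_dualNormSq (η : DualTotal L) {w : E × (ℂ →L[ℂ] ℂ)}
    (hw : w ∈ (extChartAt (dualModel 𝓘(ℂ, E)) η).target) :
    1 - h.dualNormSq ((extChartAt (dualModel 𝓘(ℂ, E)) η).symm w) =
      discDefect (fiberCoord E) (fun z => h.localPotential η.1 z.1) w := by
  have hb := ((mem_target_extChartAt_dual η w).1 hw).2
  have h1 := extChartAt_dual_symm_fst η hw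
  rw [h.dualNormSq_eq _ (localFrame_ne_zero (p := η.1) (h1 ▸ hb)), ← fiberCoord_of_mem_target η hw,
    discDefect, h1, localPotential, Real.exp_neg, Real.exp_log (h.normSq_localFrame_pos hb),
    div_eq_mul_inv]

theorem extChartAt_dual_self_fst (η : DualTotal L) :
    (extChartAt (dualModel 𝓘(ℂ, E)) η η).1 = extChartAt 𝓘(ℂ, E) η.1 η.1 :=
  extChartAt_dual_fst η η

theorem HermitianLineMetric.discDefect_self (η : DualTotal L) :
    discDefect (fiberCoord E) (fun z => h.localPotential η.1 z.1)
      (extChartAt (dualModel 𝓘(ℂ, E)) η η) = 1 - h.dualNormSq η := by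
  rw [← h.one_sub_dualNormSq η (mem_extChartAt_target η), extChartAt_to_inv]

variable [IsManifold 𝓘(ℂ, E) ω M]

theorem HermitianLineMetric.contDiffAt_localPotential_fst (η : DualTotal L) :
    ContDiffAt ℝ ∞ (fun z : E × (ℂ →L[ℂ] ℂ) => h.localPotential η.1 z.1)
      (extChartAt (dualModel 𝓘(ℂ, E)) η η) := by
  refine contDiffAt_comp_fst (f := h.localPotential η.1) ?_
  rw [extChartAt_dual_self_fst]
  exact h.contDiffAt_localPotential η.1

variable [ContMDiffVectorBundle ω ℂ L 𝓘(ℂ, E)]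

theorem dualProjDeriv_eq (η : DualTotal L) (U : TangentSpace (dualModel 𝓘(ℂ, E)) η) :
    dualProjDeriv η U = (show E × (ℂ →L[ℂ] ℂ) from U).1 := by
  have hd : MDifferentiableAt (dualModel 𝓘(ℂ, E)) 𝓘(ℂ, E)
      (TotalSpace.proj : DualTotal L → M) η :=
    (contMDiffAt_proj (n := 1) (fun x => L x →L[ℂ] Bundle.Trivial M ℂ x)).mdifferentiableAt
      (by norm_num)
  have hev : writtenInExtChartAt (dualModel 𝓘(ℂ, E)) 𝓘(ℂ, E) η (TotalSpace.proj : DualTotal L → M)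
      =ᶠ[nhds (extChartAt (dualModel 𝓘(ℂ, E)) η η)] Prod.fst := by
    filter_upwards [extChartAt_target_mem_nhds (I := dualModel 𝓘(ℂ, E)) η] with w hw
    simp only [writtenInExtChartAt, Function.comp_apply]
    rw [extChartAt_dual_symm_fst η hw]
    exact (extChartAt 𝓘(ℂ, E) η.1).right_inv ((mem_target_extChartAt_dual η w).1 hw).1
  rw [dualProjDeriv, hd.mfderiv, ModelWithCorners.range_eq_univ, fderivWithin_univ, hev.fderiv_eq,
    fderiv_fst]
  rfl

end DualBundle

/-! ### Kähler metrics from local potentials. -/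

section Potential

/-- A Hermitian form which is locally `∂∂̄` of a potential is Kähler. -/
theorem isKahlerOn_of_potential {E : Type*} [NormedAddCommGroup E] [NormedSpace ℂ E]
    {H : Type*} [TopologicalSpace H] {I : ModelWithCorners ℂ E H}
    {N : Type*} [TopologicalSpace N] [ChartedSpace H N] {g : FormField I N} {S : Set N}
    (hg : ∀ p ∈ S, IsHermitianInner (V := TangentSpace I p) (g p))
    (K : N → E → ℝ) (hK : ∀ p ∈ S, ContDiffAt ℝ ∞ (K p) (extChartAt I p p))
    (hgK : ∀ p ∈ S, ∀ᶠ z in nhds (extChartAt I p p), ∀ a b,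
      coeffs I g (extChartAt I p).symm z a b = ddbar (fun z => (K p z : ℂ)) z a b) :
    IsKahlerOn I g S := by
  have hev : ∀ p ∈ S, ∀ a b, (fun z => coeffs I g (extChartAt I p).symm z a b)
      =ᶠ[nhds (extChartAt I p p)] fun z => ddbar (fun z => (K p z : ℂ)) z a b :=
    fun p hp a b => (hgK p hp).mono fun z hz => hz a b
  refine ⟨hg, fun p hp a b => ?_, fun p hp a b c => ?_⟩
  · exact ((hK p hp).ofReal.ddbar (m := ∞) (by norm_cast) a b).congr_of_eventuallyEq (hev p hp a b)
  · rw [(hev p hp a b).wirtinger_eq, (hev p hp c b).wirtinger_eq]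
    exact wirtinger_wirtinger_comm
      ((hK p hp).ofReal.wirtingerBar (m := 2) (by norm_cast) b) c a

end Potential

/-! ### The potentials of `g_M` and `g_D` in charts. -/

section DiscMetric

variable {E : Type*} [NormedAddCommGroup E] [NormedSpace ℂ E]
  {M : Type*} [TopologicalSpace M] [ChartedSpace E M] [IsManifold 𝓘(ℂ, E) ω M]
  {L : M → Type*} [∀ x, AddCommGroup (L x)] [∀ x, Module ℂ (L x)] [∀ x, TopologicalSpace (L x)]
  [TopologicalSpace (TotalSpace ℂ L)] [FiberBundle ℂ L] [VectorBundle ℂ ℂ L]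
  [ContMDiffVectorBundle ω ℂ L 𝓘(ℂ, E)]
  (h : HermitianLineMetric 𝓘(ℂ, E) L) {gM : FormField 𝓘(ℂ, E) M}
  (hcurv : ∀ (p : M) (U V : TangentSpace 𝓘(ℂ, E) p), gM p U V = h.curvatureForm p U V)

include hcurv

theorem HermitianLineMetric.eventually_coeffs_base (p : M) :
    ∀ᶠ z in nhds (extChartAt 𝓘(ℂ, E) p p), ∀ a b,
      coeffs 𝓘(ℂ, E) gM (extChartAt 𝓘(ℂ, E) p).symm z a b =
        ddbar (fun z => (h.localPotential p z : ℂ)) z a b := by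
  have hb : ∀ᶠ z in nhds (extChartAt 𝓘(ℂ, E) p p),
      (extChartAt 𝓘(ℂ, E) p).symm z ∈ (trivializationAt ℂ L p).baseSet := by
    refine (continuousAt_extChartAt_symm p).eventually
      ((trivializationAt ℂ L p).open_baseSet.mem_nhds ?_)
    rw [extChartAt_to_inv]
    exact FiberBundle.mem_baseSet_trivializationAt' p
  filter_upwards [hb, extChartAt_target_mem_nhds (I := 𝓘(ℂ, E)) p,
    ((h.contDiffAt_localPotential p).of_le (m := 2) (by norm_cast)).eventually (by norm_num)]
    with z h1 h2 h3 a b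
  exact h.coeffs_of_eq_curvatureForm hcurv (contMDiffAt_extChartAt_symm h2) h1 h3 a b

/-- At a nearby point the form is defined through the chart centred there, not the one at `η`. The
pullback of `g_M` and the Levi form are therefore both transported to the chart at `η`, where they
add up to `∂∂̄` of the disc potential. -/
theorem HermitianLineMetric.eventually_coeffs_discMetric {η : DualTotal L}
    (hη : η ∈ h.discBundle) :
    ∀ᶠ w in nhds (extChartAt (dualModel 𝓘(ℂ, E)) η η), ∀ a b,
      coeffs (dualModel 𝓘(ℂ, E)) (h.discMetric gM) (extChartAt (dualModel 𝓘(ℂ, E)) η).symm w a b =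
        ddbar (fun z => (discPotential (fiberCoord E) (fun z => h.localPotential η.1 z.1) z : ℂ))
          w a b := by
  set I' := dualModel (E := E) 𝓘(ℂ, E)
  set Φ : E × (ℂ →L[ℂ] ℂ) → ℝ := fun z => h.localPotential η.1 z.1 with hΦ
  set ψ := (extChartAt I' η).symm with hψdef
  have hΦc : ContDiffAt ℝ 2 Φ (extChartAt I' η η) :=
    (h.contDiffAt_localPotential_fst η).of_le (by norm_cast)
  have hτ : 0 < discDefect (fiberCoord E) Φ (extChartAt I' η η) := by
    rw [h.discDefect_self]
    exact sub_pos.2 hη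
  filter_upwards [extChartAt_target_mem_nhds (I := I') η, hΦc.eventually (by norm_num),
    (continuousAt_discDefect hΦc.ofReal.continuousAt).eventually (lt_mem_nhds hτ)]
    with w hw hΦw hτw a b
  have hψ : ContMDiffAt 𝓘(ℂ, E × (ℂ →L[ℂ] ℂ)) I' ω ψ w := contMDiffAt_extChartAt_symm hw
  have hwnhds : ∀ᶠ z in nhds w, z ∈ (extChartAt I' η).target :=
    (isOpen_extChartAt_target η).mem_nhds hw
  -- the pulled back base metric
  have hπ : ContMDiffAt I' 𝓘(ℂ, E) ω (TotalSpace.proj : DualTotal L → M) (ψ w) :=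
    contMDiffAt_proj (fun x => L x →L[ℂ] Bundle.Trivial M ℂ x)
  have hcomp : ContMDiffAt 𝓘(ℂ, E × (ℂ →L[ℂ] ℂ)) 𝓘(ℂ, E) ω (fun z => (ψ z).1) w :=
    hπ.comp w hψ
  have hfst : (fun z => (ψ z).1) =ᶠ[nhds w] fun z => (extChartAt 𝓘(ℂ, E) η.1).symm z.1 :=
    hwnhds.mono fun z hz => extChartAt_dual_symm_fst η hz
  have hbase : gM (ψ w).1 (dualProjDeriv (ψ w) (mfderiv 𝓘(ℂ, E × (ℂ →L[ℂ] ℂ)) I' ψ w a))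
      (dualProjDeriv (ψ w) (mfderiv 𝓘(ℂ, E × (ℂ →L[ℂ] ℂ)) I' ψ w b))
      = ddbar (fun z => (Φ z : ℂ)) w a b := by
    have h1 : coeffs 𝓘(ℂ, E) gM (fun z => (ψ z).1) w a b =
        gM (ψ w).1 (dualProjDeriv (ψ w) (mfderiv 𝓘(ℂ, E × (ℂ →L[ℂ] ℂ)) I' ψ w a))
          (dualProjDeriv (ψ w) (mfderiv 𝓘(ℂ, E × (ℂ →L[ℂ] ℂ)) I' ψ w b)) := by
      unfold coeffs
      rw [show mfderiv 𝓘(ℂ, E × (ℂ →L[ℂ] ℂ)) 𝓘(ℂ, E) (fun z => (ψ z).1) w = _ from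
        mfderiv_comp (I' := I') w (hπ.mdifferentiableAt (by norm_num))
          (hψ.mdifferentiableAt (by norm_num))]
      rfl
    refine h1.symm.trans ?_
    rw [coeffs_congr _ hfst]
    refine h.coeffs_of_eq_curvatureForm hcurv (hcomp.congr_of_eventuallyEq hfst.symm) ?_ hΦw a b
    exact ((mem_target_extChartAt_dual η w).1 hw).2
  -- the fibrewise part
  have hdw : 1 - h.dualNormSq (ψ w) = discDefect (fiberCoord E) Φ w := h.one_sub_dualNormSq η hw
  have hf : ContDiffAt ℝ 2 ((fun ξ : DualTotal L => Real.log (1 - h.dualNormSq ξ)) ∘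
      (extChartAt I' (ψ w)).symm) (extChartAt I' (ψ w) (ψ w)) := by
    have h1 : ContDiffAt ℝ 2 (fun z => Real.log (discDefect (fiberCoord E)
        (fun z => h.localPotential (ψ w).1 z.1) z)) (extChartAt I' (ψ w) (ψ w)) := by
      refine ContDiffAt.log (contDiffAt_discDefect
        ((h.contDiffAt_localPotential_fst (ψ w)).of_le (by norm_cast))) ?_
      rw [h.discDefect_self, hdw]
      exact hτw.ne'
    refine h1.congr_of_eventuallyEq ?_
    filter_upwards [extChartAt_target_mem_nhds (I := I') (ψ w)] with z hz
    simp only [Function.comp_apply]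
    rw [h.one_sub_dualNormSq (ψ w) hz]
  have hfib : leviForm I' (fun ξ : DualTotal L => Real.log (1 - h.dualNormSq ξ)) (ψ w)
      (mfderiv 𝓘(ℂ, E × (ℂ →L[ℂ] ℂ)) I' ψ w a) (mfderiv 𝓘(ℂ, E × (ℂ →L[ℂ] ℂ)) I' ψ w b)
      = ddbar (fun z => (Real.log (discDefect (fiberCoord E) Φ z) : ℂ)) w a b := by
    refine (coeffs_leviForm (hψ.of_le le_top) hf a b).trans ?_
    refine Filter.EventuallyEq.ddbar_eq (hwnhds.mono fun z hz => ?_) a b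
    exact congrArg (fun t : ℝ => (Real.log t : ℂ)) (h.one_sub_dualNormSq η hz)
  unfold coeffs HermitianLineMetric.discMetric
  rw [hbase, hfib, sub_eq_add_neg, ← ddbar_neg, ← ddbar_add hΦw.ofReal
    ((contDiffAt_discDefect hΦw).log hτw.ne').ofReal.neg]
  simp [discPotential, sub_eq_add_neg]

end DiscMetric

/-! ### The Kähler property and the curvature formula on the disc bundle. -/

section Kahler

variable {E : Type*} [NormedAddCommGroup E] [NormedSpace ℂ E]
  {M : Type*} [TopologicalSpace M] [ChartedSpace E M] [IsManifold 𝓘(ℂ, E) ω M]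
  {L : M → Type*} [∀ x, AddCommGroup (L x)] [∀ x, Module ℂ (L x)] [∀ x, TopologicalSpace (L x)]
  [TopologicalSpace (TotalSpace ℂ L)] [FiberBundle ℂ L] [VectorBundle ℂ ℂ L]
  [ContMDiffVectorBundle ω ℂ L 𝓘(ℂ, E)]
  (h : HermitianLineMetric 𝓘(ℂ, E) L) {gM : FormField 𝓘(ℂ, E) M}
  (hgM : IsKahlerOn 𝓘(ℂ, E) gM Set.univ)
  (hcurv : ∀ (p : M) (U V : TangentSpace 𝓘(ℂ, E) p), gM p U V = h.curvatureForm p U V)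

include hgM hcurv

theorem HermitianLineMetric.isHermitianInner_localPotential (p : M) :
    IsHermitianInner (ddbar (fun z => (h.localPotential p z : ℂ)) (extChartAt 𝓘(ℂ, E) p p)) := by
  have h1 : ddbar (fun z => (h.localPotential p z : ℂ)) (extChartAt 𝓘(ℂ, E) p p)
      = (gM p : E → E → ℂ) := by
    funext a b
    rw [← (h.eventually_coeffs_base hcurv p).self_of_nhds a b, coeffs_extChartAt_symm_self]
  rw [h1]
  exact hgM.hermitian p (Set.mem_univ p)

theorem HermitianLineMetric.isHermitianInner_discMetric {η : DualTotal L}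
    (hη : η ∈ h.discBundle) :
    IsHermitianInner (V := E × (ℂ →L[ℂ] ℂ)) (h.discMetric gM η) := by
  have h1 : (h.discMetric gM η : E × (ℂ →L[ℂ] ℂ) → E × (ℂ →L[ℂ] ℂ) → ℂ) =
      ddbar (fun z => (discPotential (fiberCoord E) (fun z => h.localPotential η.1 z.1) z : ℂ))
        (extChartAt (dualModel 𝓘(ℂ, E)) η η) := by
    funext a b
    rw [← (h.eventually_coeffs_discMetric hcurv hη).self_of_nhds a b]
    exact (coeffs_extChartAt_symm_self (I := dualModel 𝓘(ℂ, E)) _ η a b).symm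
  rw [h1]
  refine isHermitianInner_ddbar_discPotential ?_ ?_ ?_
  · rw [extChartAt_dual_self_fst]
    exact (h.contDiffAt_localPotential η.1).of_le (by norm_cast)
  · rw [extChartAt_dual_self_fst]
    exact h.isHermitianInner_localPotential hgM hcurv η.1
  · rw [h.discDefect_self]
    exact sub_pos.2 hη

theorem HermitianLineMetric.isKahlerOn_discMetric :
    IsKahlerOn (dualModel 𝓘(ℂ, E)) (h.discMetric gM) h.discBundle := by
  refine isKahlerOn_of_potential (fun η hη => h.isHermitianInner_discMetric hgM hcurv hη)
    (fun η => discPotential (fiberCoord E) (fun z => h.localPotential η.1 z.1)) (fun η hη => ?_)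
    (fun η hη => h.eventually_coeffs_discMetric hcurv hη)
  refine contDiffAt_discPotential (h.contDiffAt_localPotential_fst η) ?_
  rw [h.discDefect_self]
  exact sub_pos.2 hη

/-- The chart of `L*` at `η` lies over the chart of `M` at `η.1`, so both curvatures are read off in
the coordinates of `holSectCurvCoord_disc`. -/
theorem HermitianLineMetric.holSectCurv_discMetric [FiniteDimensional ℂ E] {η : DualTotal L}
    (hη : η ∈ h.discBundle) {U : TangentSpace (dualModel 𝓘(ℂ, E)) η} (hU : U ≠ 0) :
    holSectCurv (dualModel 𝓘(ℂ, E)) (h.discMetric gM) η U =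
      -2 * ((h.discMetric gM η U U).re ^ 2 -
          (gM η.1 (dualProjDeriv η U) (dualProjDeriv η U)).re ^ 2 / (1 - h.dualNormSq η) *
            (1 + 1 / 2 * holSectCurv 𝓘(ℂ, E) gM η.1 (dualProjDeriv η U))) /
        (h.discMetric gM η U U).re ^ 2 := by
  have h4 : ContDiffAt ℝ 4 (h.localPotential η.1) (extChartAt 𝓘(ℂ, E) η.1 η.1) :=
    (h.contDiffAt_localPotential η.1).of_le (by norm_cast)
  have hg := h.eventually_coeffs_base hcurv η.1
  have hherm : IsHermitianInner (V := E) (coeffs 𝓘(ℂ, E) gM (extChartAt 𝓘(ℂ, E) η.1).symm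
      (extChartAt 𝓘(ℂ, E) η.1 η.1)) := by
    rw [funext fun a => funext fun b => coeffs_extChartAt_symm_self gM η.1 a b]
    exact hgM.hermitian η.1 (Set.mem_univ _)
  rw [← extChartAt_dual_self_fst η] at h4 hg hherm
  have hτ : 0 < discDefect (fiberCoord E) (fun z => h.localPotential η.1 z.1)
      (extChartAt (dualModel 𝓘(ℂ, E)) η η) := by
    rw [h.discDefect_self]
    exact sub_pos.2 hη
  have key := holSectCurvCoord_disc h4 hg hherm hτ (h.eventually_coeffs_discMetric hcurv hη)
    (u := U) hU
  rw [h.discDefect_self, extChartAt_dual_self_fst] at key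
  have hGU := coeffs_extChartAt_symm_self (I := dualModel 𝓘(ℂ, E)) (h.discMetric gM) η U U
  have hgU := fun a => coeffs_extChartAt_symm_self gM η.1 a a
  rw [hGU, hgU] at key
  rw [dualProjDeriv_eq]
  exact key

end Kahler

/-! ### Product rules along holomorphic vector fields. -/

section Apply

variable {E : Type*} [NormedAddCommGroup E] [NormedSpace ℂ E]
  {E' : Type*} [NormedAddCommGroup E'] [NormedSpace ℂ E']

theorem HasWirtingerAt.sum {ι : Type*} (s : Finset ι) {F : ι → E → ℂ} {x u : E} {d d' : ι → ℂ}
    (hF : ∀ i, HasWirtingerAt (F i) x u (d i) (d' i)) :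
    HasWirtingerAt (fun y => ∑ i ∈ s, F i y) x u (∑ i ∈ s, d i) (∑ i ∈ s, d' i) := by
  classical
  induction s using Finset.induction_on with
  | empty => simpa using HasWirtingerAt.const 0 x u
  | insert i s hi ih => simpa only [Finset.sum_insert hi] using (hF i).add ih

/-- Product rule for a family of linear forms applied to a holomorphic vector field. -/
theorem HasWirtingerAt.linear_apply [FiniteDimensional ℂ E] {Γ : E' → E → ℂ} {V : E' → E}
    {y c : E'} {α β : E → ℂ} (hlin : ∀ᶠ z in nhds y, IsLinearMap ℂ (Γ z))
    (hΓ : ∀ d, HasWirtingerAt (fun z => Γ z d) y c (α d) (β d)) (hV : DifferentiableAt ℂ V y) :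
    HasWirtingerAt (fun z => Γ z (V z)) y c (α (V y) + Γ y (fderiv ℂ V y c)) (β (V y)) := by
  let e := Module.finBasis ℂ E
  let co : Fin (Module.finrank ℂ E) → E →L[ℂ] ℂ := fun k => LinearMap.toContinuousLinearMap (e.coord k)
  have hexp : ∀ z, IsLinearMap ℂ (Γ z) → ∀ d, Γ z d = ∑ k, co k d * Γ z (e k) := fun z hz d => by
    conv_lhs => rw [← e.sum_repr d]
    have := map_sum (hz.mk' _) (fun k => e.repr d k • e k) Finset.univ
    simp only [IsLinearMap.mk'_apply, hz.map_smul] at this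
    exact this
  have hco : ∀ k, HasWirtingerAt (fun z => co k (V z)) y c (co k (fderiv ℂ V y c)) 0 := fun k => by
    have h1 := (co k).hasFDerivAt.comp y hV.hasFDerivAt
    have h2 := HasWirtingerAt.of_holomorphic h1.differentiableAt c
    rw [h1.fderiv] at h2
    exact h2
  have hconst : HasWirtingerAt (fun z => Γ z (V y)) y c
      (∑ k, (0 * Γ y (e k) + co k (V y) * α (e k))) (∑ k, (0 * Γ y (e k) + co k (V y) * β (e k))) :=
    (HasWirtingerAt.sum Finset.univ fun k => (HasWirtingerAt.const (co k (V y)) y c).mul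
      (hΓ (e k))).congr_of_eventuallyEq (hlin.mono fun z hz => hexp z hz (V y))
  have h1 : α (V y) = _ := (hΓ (V y)).wirt.symm.trans hconst.wirt
  have h2 : β (V y) = _ := (hΓ (V y)).bar.symm.trans hconst.bar
  have hmain := (HasWirtingerAt.sum Finset.univ fun k => (hco k).mul
      (hΓ (e k))).congr_of_eventuallyEq (hlin.mono fun z hz => hexp z hz (V z))
  refine hmain.congr_deriv ?_ ?_
  · rw [h1, hexp y hlin.self_of_nhds (fderiv ℂ V y c), ← Finset.sum_add_distrib]
    exact Finset.sum_congr rfl fun k _ => by ring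
  · rw [h2]

/-- Product rule for a family of sesquilinear forms applied to holomorphic vector fields. -/
theorem wirtinger_sesquilinear_apply [FiniteDimensional ℂ E] {Γ : E' → E → E → ℂ} {V W : E' → E}
    {y c : E'} (hadd : ∀ᶠ z in nhds y, ∀ a b d, Γ z (a + b) d = Γ z a d + Γ z b d)
    (hsmul : ∀ᶠ z in nhds y, ∀ (k : ℂ) a d, Γ z (k • a) d = k * Γ z a d)
    (hconj : ∀ᶠ z in nhds y, ∀ a d, (starRingEnd ℂ) (Γ z a d) = Γ z d a)
    (hΓ : ∀ a d, DifferentiableAt ℝ (fun z => Γ z a d) y)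
    (hV : DifferentiableAt ℂ V y) (hW : DifferentiableAt ℂ W y) :
    wirtinger (fun z => Γ z (V z) (W z)) y c =
      wirtinger (fun z => Γ z (V y) (W y)) y c + Γ y (fderiv ℂ V y c) (W y) := by
  have h1 : ∀ a, HasWirtingerAt (fun z => Γ z (W z) a) y c _ _ := fun a =>
    HasWirtingerAt.linear_apply (Γ := fun z d => Γ z d a)
      (by filter_upwards [hadd, hsmul] with z h1 h2 using ⟨fun _ _ => h1 _ _ _, fun _ _ => h2 _ _ _⟩)
      (fun d => HasWirtingerAt.of_differentiableAt (hΓ d a) c) hW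
  -- In the conjugate linear slot the holomorphic field `W` varies antiholomorphically, so it
  -- contributes nothing to `∂`.
  have h2 : ∀ a, HasWirtingerAt (fun z => Γ z a (W z)) y c
      (wirtinger (fun z => Γ z a (W y)) y c) _ := fun a =>
    ((h1 a).conj.congr_of_eventuallyEq (hconj.mono fun z hz => (hz _ _).symm)).congr_deriv
      (by
        rw [← wirtinger_conj]
        exact Filter.EventuallyEq.wirtinger_eq (hconj.mono fun z hz => hz _ _) c) rfl
  exact (HasWirtingerAt.linear_apply (Γ := fun z d => Γ z d (W z))
      (by filter_upwards [hadd, hsmul] with z h1 h2 using ⟨fun _ _ => h1 _ _ _, fun _ _ => h2 _ _ _⟩)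
      h2 hV).wirt

end Apply

/-! ### Geodesic parameters for a Kähler potential. -/

section Geodesic

variable {E : Type*} [NormedAddCommGroup E] [NormedSpace ℂ E] [FiniteDimensional ℂ E]

theorem IsHermitianInner.exists_euclidean_equiv {m : ℕ} {g : E → E → ℂ} (hg : IsHermitianInner g)
    (hm : Module.finrank ℂ E = m) :
    ∃ A : EuclideanSpace ℂ (Fin m) ≃L[ℂ] E,
      ∀ a b, g (A a) (A b) = ∑ j, a j * (starRingEnd ℂ) (b j) := by
  subst hm
  obtain ⟨e, he⟩ := hg.exists_orthonormal_basis
  refine ⟨((WithLp.linearEquiv 2 ℂ _).trans e.equivFun.symm).toContinuousLinearEquiv, fun a b => ?_⟩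
  have hA : ∀ a, ((WithLp.linearEquiv 2 ℂ _).trans e.equivFun.symm).toContinuousLinearEquiv a
      = ∑ i, a i • e i := fun a => by
    simp [Module.Basis.equivFun_symm_apply]
  rw [hA, hA, hg.sum_left]
  refine Finset.sum_congr rfl fun i _ => ?_
  rw [hg.smul_left, hg.sum_right]
  simp [hg.smul_right, he]

/-- Holomorphic parameters in which the metric with potential `φ` is standard to first order. -/
theorem exists_geodesic_param {m : ℕ} (hm : Module.finrank ℂ E = m) {φ : E → ℝ} {x : E}
    (hφ : ContDiffAt ℝ 4 φ x) (hg : IsHermitianInner (ddbar (fun z => (φ z : ℂ)) x)) :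
    ∃ (ψ : EuclideanSpace ℂ (Fin m) → E) (A : EuclideanSpace ℂ (Fin m) ≃L[ℂ] E),
      ContDiff ℂ ω ψ ∧ ψ 0 = x ∧ HasFDerivAt ψ (A : EuclideanSpace ℂ (Fin m) →L[ℂ] E) 0 ∧
      (∀ a b, ddbar (fun z => (φ z : ℂ)) x (A a) (A b) = ∑ j, a j * (starRingEnd ℂ) (b j)) ∧
      ∀ a b c, wirtinger (fun y => ddbar (fun z => (φ z : ℂ)) (ψ y) (fderiv ℂ ψ y a)
        (fderiv ℂ ψ y b)) 0 c = 0 := by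
  obtain ⟨A, hA⟩ := hg.exists_euclidean_equiv hm
  obtain ⟨e, he⟩ := hg.exists_orthonormal_basis
  have hφ3 : ContDiffAt ℝ 3 (fun z => (φ z : ℂ)) x := (hφ.of_le (by norm_num)).ofReal
  have hφ2 : ContDiffAt ℝ 2 (fun z => (φ z : ℂ)) x := (hφ.of_le (by norm_num)).ofReal
  set W : E → E → E → ℂ := fun c a d => wirtinger (fun y => ddbar (fun z => (φ z : ℂ)) y a d) x c
    with hW
  have hdd : ∀ a d, DifferentiableAt ℝ (fun y => ddbar (fun z => (φ z : ℂ)) y a d) x := fun a d =>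
    (hφ3.ddbar (m := 1) (by norm_num) a d).differentiableAt (by norm_num)
  have hWadd1 : ∀ c c' a d, W (c + c') a d = W c a d + W c' a d := fun _ _ _ _ =>
    wirtinger_add_right _ _ _ _
  have hWsmul1 : ∀ (k : ℂ) c a d, W (k • c) a d = k * W c a d := fun _ _ _ _ =>
    wirtinger_smul_right _ _ _ _
  -- The Kähler condition, which makes the correction `B` below symmetric.
  have hWsymm : ∀ c a d, W c a d = W a c d := fun c a d =>
    wirtinger_wirtinger_comm (hφ3.wirtingerBar (by norm_num) d) c a
  let B : E →ₗ[ℂ] E →ₗ[ℂ] E := LinearMap.mk₂ ℂ (fun c a => -∑ k, W c a (e k) • e k)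
    (fun c c' a => by
      simp only [hWadd1, add_smul, Finset.sum_add_distrib]; abel)
    (fun k c a => by
      simp only [hWsmul1, mul_smul, ← Finset.smul_sum, smul_neg])
    (fun c a a' => by
      simp only [hWsymm c, hWadd1, add_smul, Finset.sum_add_distrib]; abel)
    (fun k c a => by
      simp only [hWsymm c, hWsmul1, mul_smul, ← Finset.smul_sum, smul_neg])
  have hBsymm : ∀ c a, B c a = B a c := fun c a => by
    simp only [B, LinearMap.mk₂_apply, hWsymm c a]
  have hBg : ∀ c a d, ddbar (fun z => (φ z : ℂ)) x (B c a) d = -W c a d := fun c a d => by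
    have h1 := hg.eq_sum_of_conj_linear he (ℓ := fun d => W c a d)
      (fun u v => wirtinger_ddbar_add_right_ofReal hφ3 _ _ _ _)
      (fun k u => wirtinger_ddbar_smul_right_ofReal hφ3 _ _ _ _) d
    simp only [B, LinearMap.mk₂_apply]
    rw [h1, ← neg_one_smul ℂ, hg.smul_left]
    ring
  let B' : E →L[ℂ] E →L[ℂ] E := B.toContinuousBilinearMap
  have hB' : ∀ c a, B' c a = B c a := fun c a => rfl
  -- By symmetry of `B` the factor one half gives `dψ_y(a) = A a + B(A y, A a)`. Its derivative at
  -- `0` along `c` is `B(A c, A a)`, which represents minus the first derivative of the metric.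
  let ψ : EuclideanSpace ℂ (Fin m) → E := fun y => x + A y + (2⁻¹ : ℂ) • B' (A y) (A y)
  have hψd : ∀ y, HasFDerivAt ψ ((A : EuclideanSpace ℂ (Fin m) →L[ℂ] E)
      + (B' (A y)).comp (A : EuclideanSpace ℂ (Fin m) →L[ℂ] E)) y := fun y => by
    have hA1 := (A : EuclideanSpace ℂ (Fin m) →L[ℂ] E).hasFDerivAt (x := y)
    have h1 := ((hasFDerivAt_const x y).add hA1).add
      (((B'.hasFDerivAt.comp y hA1).clm_apply hA1).const_smul (2⁻¹ : ℂ))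
    refine h1.congr_fderiv ?_
    ext a : 1
    simp only [zero_add, add_apply, FunLike.coe_smul, Pi.smul_apply,
      ContinuousLinearMap.comp_apply, ContinuousLinearMap.flip_apply, Function.comp_apply, hB',
      ContinuousLinearEquiv.coe_coe]
    rw [hBsymm (A a) (A y), ← two_smul ℂ, smul_smul]
    norm_num
  have hψf : ∀ y a, fderiv ℂ ψ y a = A a + B' (A y) (A a) := fun y a => by
    rw [(hψd y).fderiv]; rfl
  have hψ0 : ψ 0 = x := by simp [ψ]
  have hψc : ContDiff ℂ ω ψ := by
    have hA1 : ContDiff ℂ ω (fun y => A y) := A.contDiff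
    exact (contDiff_const.add hA1).add (((B'.contDiff.comp hA1).clm_apply hA1).const_smul _)
  have hd0 : HasFDerivAt ψ (A : EuclideanSpace ℂ (Fin m) →L[ℂ] E) 0 := by
    simpa using hψd 0
  refine ⟨ψ, A, hψc, hψ0, hd0, hA, fun a b c => ?_⟩
  have hcont : ∀ᶠ z in nhds (0 : EuclideanSpace ℂ (Fin m)),
      ContDiffAt ℝ 2 (fun z => (φ z : ℂ)) (ψ z) := by
    have := hψc.continuous.continuousAt (x := (0 : EuclideanSpace ℂ (Fin m)))
    rw [ContinuousAt, hψ0] at this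
    exact this.eventually (hφ2.eventually (by norm_num))
  have hV : ∀ a, HasFDerivAt (fun y => fderiv ℂ ψ y a)
      ((B'.flip (A a)).comp (A : EuclideanSpace ℂ (Fin m) →L[ℂ] E)) 0 := fun a => by
    simp only [hψf]
    exact (((B'.flip (A a)).comp (A : EuclideanSpace ℂ (Fin m) →L[ℂ] E)).hasFDerivAt).const_add _
  have hcomp : ∀ a d, wirtinger (fun y => ddbar (fun z => (φ z : ℂ)) (ψ y) a d) 0 c
      = W (A c) a d := fun a d => by
    have h1 := hdd a d
    rw [← hψ0] at h1
    rw [wirtinger_comp (F := fun y => ddbar (fun z => (φ z : ℂ)) y a d) h1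
      hd0.differentiableAt, hψ0, hd0.fderiv]
    rfl
  rw [wirtinger_sesquilinear_apply (Γ := fun z => ddbar (fun z => (φ z : ℂ)) (ψ z))
    (V := fun y => fderiv ℂ ψ y a) (W := fun y => fderiv ℂ ψ y b)
    (.of_forall fun _ _ _ _ => ddbar_add_left _ _ _ _ _)
    (.of_forall fun _ _ _ _ => ddbar_smul_left _ _ _ _ _)
    (hcont.mono fun z hz a d => conj_ddbar_ofReal hz a d)
    (fun a d => by
      have h1 := hdd a d
      rw [← hψ0] at h1
      exact h1.comp _ (hd0.restrictScalars ℝ).differentiableAt)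
    (hV a).differentiableAt (hV b).differentiableAt, hcomp, (hV a).fderiv, hψ0, hd0.fderiv]
  simp only [ContinuousLinearMap.comp_apply, ContinuousLinearMap.flip_apply,
    ContinuousLinearEquiv.coe_coe, hB', hBg]
  ring

end Geodesic

/-! ### Holomorphic charts from the inverse function theorem. -/

section Charts

/-- A local inverse of `ψ`, shrunk so that it is analytic on its whole source and stays inside `S`.
The inverse map equals `ψ` everywhere, so derivatives of `ψ` transfer directly. -/
theorem exists_openPartialHomeomorph_symm_eq {E E' : Type*} [NormedAddCommGroup E]
    [NormedSpace ℂ E] [NormedAddCommGroup E'] [NormedSpace ℂ E'] [CompleteSpace E']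
    {ψ : E' → E} {A : E' ≃L[ℂ] E} (hψ : ContDiff ℂ ω ψ)
    (hA : HasFDerivAt ψ (A : E' →L[ℂ] E) 0) {S : Set E} (hS : S ∈ nhds (ψ 0)) :
    ∃ κ : OpenPartialHomeomorph E E', (∀ y, κ.symm y = ψ y) ∧ ψ 0 ∈ κ.source ∧ κ (ψ 0) = 0 ∧
      κ.source ⊆ S ∧ ContDiffOn ℂ ω κ κ.source := by
  have hc : ContDiffAt ℂ ω ψ 0 := hψ.contDiffAt
  have hω : (ω : WithTop ℕ∞) ≠ 0 := by simp
  let e := (hc.toOpenPartialHomeomorph ψ hA hω).symm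
  have h0 : ψ 0 ∈ e.source := hc.image_mem_toOpenPartialHomeomorph_target hA hω
  have hinv : ContDiffAt ℂ ω e (ψ 0) := hc.to_localInverse hA hω
  have he0 : e (ψ 0) = 0 := hc.localInverse_apply_image hA hω
  have hev : {z | ContDiffAt ℂ ω e z} ∩ S ∈ nhds (ψ 0) :=
    Filter.inter_mem (hinv.eventually (by simp)) hS
  refine ⟨e.restr ({z | ContDiffAt ℂ ω e z} ∩ S), fun y => rfl, ?_, he0, ?_, ?_⟩
  · rw [OpenPartialHomeomorph.restr_source]
    exact ⟨h0, mem_interior_iff_mem_nhds.2 hev⟩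
  · rw [OpenPartialHomeomorph.restr_source]
    exact fun z hz => (interior_subset hz.2).2
  · intro z hz
    rw [OpenPartialHomeomorph.restr_source] at hz
    have h : ContDiffAt ℂ ω e z := (interior_subset hz.2).1
    exact h.contDiffWithinAt

variable {E : Type*} [NormedAddCommGroup E] [NormedSpace ℂ E]
  {H : Type*} [TopologicalSpace H] (I : ModelWithCorners ℂ E H) [I.Boundaryless]
  {N : Type*} [TopologicalSpace N] [ChartedSpace H N]
  {E' : Type*} [NormedAddCommGroup E'] [NormedSpace ℂ E']

/-- The preferred chart of a manifold without boundary, with values in the model space. -/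
noncomputable def extChartHomeo (p : N) : OpenPartialHomeomorph N E :=
  (chartAt H p).trans I.toHomeomorph.toOpenPartialHomeomorph

theorem extChartHomeo_apply (p q : N) : extChartHomeo I p q = extChartAt I p q := rfl

theorem extChartHomeo_source (p : N) : (extChartHomeo I p).source = (extChartAt I p).source := by
  simp [extChartHomeo]

theorem extChartHomeo_target (p : N) : (extChartHomeo I p).target = (extChartAt I p).target := by
  rw [← (extChartHomeo I p).image_source_eq_target, extChartHomeo_source,
    ← (extChartAt I p).image_source_eq_target]
  rfl

variable [IsManifold I ω N] {I}

theorem isHolomorphicChart_extChartHomeo_trans (p : N) {κ : OpenPartialHomeomorph E E'}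
    (h1 : ContDiffOn ℂ ω κ κ.source) (h2 : ContDiffOn ℂ ω κ.symm κ.target) :
    IsHolomorphicChart I ((extChartHomeo I p).trans κ) := by
  constructor
  · rw [OpenPartialHomeomorph.trans_source, extChartHomeo_source]
    refine (h1.contMDiffOn).comp ((contMDiffOn_extChartAt (x := p)).mono ?_) ?_
    · intro q hq
      simpa using hq.1
    · exact fun q hq => hq.2
  · rw [OpenPartialHomeomorph.trans_target, extChartHomeo_target]
    refine (contMDiffOn_extChartAt_symm p).comp (h2.contMDiffOn.mono fun y hy => hy.1) ?_
    exact fun q hq => hq.2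

end Charts

/-! ### Change of frame as a change of coordinates on `L*`. -/

section LineCoordinates

variable {E : Type*} [NormedAddCommGroup E] [NormedSpace ℂ E]
  {E' : Type*} [NormedAddCommGroup E'] [NormedSpace ℂ E']

/-- The coordinates `(κ w, f(κ w) v)` on the model of the dual line bundle. -/
noncomputable def lineCoordinates (κ : OpenPartialHomeomorph E E') (f : E' → ℂ)
    (hf : Continuous f) (hf0 : ∀ y, f y ≠ 0) :
    OpenPartialHomeomorph (E × (ℂ →L[ℂ] ℂ)) (E' × ℂ) where
  toFun w := (κ w.1, f (κ w.1) * fiberCoord E w)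
  invFun q := (κ.symm q.1, (q.2 / f q.1) • ContinuousLinearMap.id ℂ ℂ)
  source := κ.source ×ˢ Set.univ
  target := κ.target ×ˢ Set.univ
  map_source' w hw := ⟨κ.map_source hw.1, trivial⟩
  map_target' q hq := ⟨κ.map_target hq.1, trivial⟩
  left_inv' w hw := by
    refine Prod.ext (κ.left_inv hw.1) (ContinuousLinearMap.ext_ring ?_)
    have := hf0 (κ w.1)
    simp [fiberCoord_apply]
    field_simp
  right_inv' q hq := by
    have := hf0 q.1
    refine Prod.ext (κ.right_inv hq.1) ?_
    simp [fiberCoord_apply, κ.right_inv hq.1]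
    field_simp
  open_source := κ.open_source.prod isOpen_univ
  open_target := κ.open_target.prod isOpen_univ
  continuousOn_toFun := by
    have h1 : ContinuousOn (fun w : E × (ℂ →L[ℂ] ℂ) => κ w.1) (κ.source ×ˢ Set.univ) :=
      κ.continuousOn.comp continuousOn_fst fun w hw => hw.1
    exact h1.prodMk ((hf.comp_continuousOn h1).mul (fiberCoord E).continuous.continuousOn)
  continuousOn_invFun := by
    have h1 : ContinuousOn (fun q : E' × ℂ => κ.symm q.1) (κ.target ×ˢ Set.univ) :=
      κ.continuousOn_symm.comp continuousOn_fst fun w hw => hw.1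
    refine h1.prodMk (Continuous.continuousOn ?_)
    exact (continuous_snd.div (hf.comp continuous_fst) fun q => hf0 q.1).smul continuous_const

variable {κ : OpenPartialHomeomorph E E'} {f : E' → ℂ}

theorem contDiffOn_lineCoordinates (hκ : ContDiffOn ℂ ω κ κ.source) (hf : ContDiff ℂ ω f)
    (hf0 : ∀ y, f y ≠ 0) : ContDiffOn ℂ ω (lineCoordinates κ f hf.continuous hf0)
      (lineCoordinates κ f hf.continuous hf0).source := by
  have h1 : ContDiffOn ℂ ω (fun w : E × (ℂ →L[ℂ] ℂ) => κ w.1) (κ.source ×ˢ Set.univ) :=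
    hκ.comp contDiffOn_fst fun w hw => hw.1
  exact h1.prodMk ((hf.comp_contDiffOn h1).mul (fiberCoord E).contDiff.contDiffOn)

theorem contDiffOn_lineCoordinates_symm (hκ : ContDiffOn ℂ ω κ.symm κ.target)
    (hf : ContDiff ℂ ω f) (hf0 : ∀ y, f y ≠ 0) :
    ContDiffOn ℂ ω (lineCoordinates κ f hf.continuous hf0).symm
      (lineCoordinates κ f hf.continuous hf0).target := by
  have h1 : ContDiffOn ℂ ω (fun q : E' × ℂ => κ.symm q.1) (κ.target ×ˢ Set.univ) :=
    hκ.comp contDiffOn_fst fun w hw => hw.1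
  have h2 : ContDiff ℂ ω (fun q : E' × ℂ => (q.2 / f q.1) • ContinuousLinearMap.id ℂ ℂ) :=
    (contDiff_snd.div (hf.comp contDiff_fst) fun q => hf0 q.1).smul contDiff_const
  exact h1.prodMk h2.contDiffOn

/-- The derivative of the inverse of `lineCoordinates`, in terms of the base and fibre parts. -/
theorem fderiv_lineCoordinates_symm {A : E' →L[ℂ] E} (hf : ContDiff ℂ ω f) (hf0 : ∀ y, f y ≠ 0)
    {y : E'} {v : ℂ} (hκ : HasFDerivAt κ.symm A y) (a : E') (α : ℂ) :
    DifferentiableAt ℂ (lineCoordinates κ f hf.continuous hf0).symm (y, v) ∧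
    (fderiv ℂ (lineCoordinates κ f hf.continuous hf0).symm (y, v) (a, α)).1 = A a ∧
    fiberCoord E (fderiv ℂ (lineCoordinates κ f hf.continuous hf0).symm (y, v) (a, α)) =
      α / f y - v * fderiv ℂ f y a / f y ^ 2 := by
  have hfd : HasFDerivAt f (fderiv ℂ f y) y :=
    (hf.differentiable (by simp)).differentiableAt.hasFDerivAt
  have h1 : HasFDerivAt (fun q : E' × ℂ => κ.symm q.1) _ (y, v) :=
    HasFDerivAt.comp (y, v) (f := Prod.fst) hκ hasFDerivAt_fst
  have h2 : HasFDerivAt (fun q : E' × ℂ => (f q.1)⁻¹) _ (y, v) :=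
    (hasDerivAt_inv (hf0 y)).comp_hasFDerivAt (y, v)
      (HasFDerivAt.comp (y, v) (f := Prod.fst) hfd hasFDerivAt_fst)
  have h3 := (hasFDerivAt_snd (𝕜 := ℂ) (p := (y, v))).mul h2
  have h4 := h3.smul_const (ContinuousLinearMap.id ℂ ℂ)
  have h5 := h1.prodMk h4
  have h6 : HasFDerivAt (lineCoordinates κ f hf.continuous hf0).symm _ (y, v) := h5
  rw [h6.fderiv]
  refine ⟨h6.differentiableAt, ?_, ?_⟩
  · simp
  · simp [fiberCoord_apply]
    ring

end LineCoordinates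

/-! ### Adapted coordinates at a point of the disc bundle. -/

section AdaptedCoordinates

variable {E : Type*} [NormedAddCommGroup E] [NormedSpace ℂ E]
  {M : Type*} [TopologicalSpace M] [ChartedSpace E M] [IsManifold 𝓘(ℂ, E) ω M]
  {L : M → Type*} [∀ x, AddCommGroup (L x)] [∀ x, Module ℂ (L x)] [∀ x, TopologicalSpace (L x)]
  [TopologicalSpace (TotalSpace ℂ L)] [FiberBundle ℂ L] [VectorBundle ℂ ℂ L]
  [ContMDiffVectorBundle ω ℂ L 𝓘(ℂ, E)]

section Base

variable (h : HermitianLineMetric 𝓘(ℂ, E) L) {gM : FormField 𝓘(ℂ, E) M}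
  (hcurv : ∀ (p : M) (U V : TangentSpace 𝓘(ℂ, E) p), gM p U V = h.curvatureForm p U V)
  {m : ℕ} {p : M} {ψ : EuclideanSpace ℂ (Fin m) → E}
  {κ : OpenPartialHomeomorph E (EuclideanSpace ℂ (Fin m))}
include hcurv

theorem HermitianLineMetric.isGeodesicAt
    (hψ : ContDiff ℂ ω ψ) (hψ0 : ψ 0 = extChartAt 𝓘(ℂ, E) p p)
    (hunit : ∀ a b, ddbar (fun z => (h.localPotential p z : ℂ)) (extChartAt 𝓘(ℂ, E) p p)
      (fderiv ℂ ψ 0 a) (fderiv ℂ ψ 0 b) = ∑ j, a j * (starRingEnd ℂ) (b j))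
    (hgeo : ∀ a b c, wirtinger (fun y => ddbar (fun z => (h.localPotential p z : ℂ)) (ψ y)
      (fderiv ℂ ψ y a) (fderiv ℂ ψ y b)) 0 c = 0)
    (hκψ : ∀ y, κ.symm y = ψ y) (hκ0 : ψ 0 ∈ κ.source) (hκ00 : κ (ψ 0) = 0)
    (hκ : ContDiffOn ℂ ω κ κ.source) :
    IsGeodesicAt 𝓘(ℂ, E) gM ((extChartHomeo 𝓘(ℂ, E) p).trans κ) p := by
  set z := (extChartHomeo 𝓘(ℂ, E) p).trans κ with hz
  have hzp : z p = 0 := by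
    rw [hz, OpenPartialHomeomorph.trans_apply, extChartHomeo_apply, ← hψ0, hκ00]
  have hzsymm : (z.symm : EuclideanSpace ℂ (Fin m) → M) =
      fun y => (extChartAt 𝓘(ℂ, E) p).symm (ψ y) := funext fun y => by
    rw [← hκψ]; rfl
  have htend : Filter.Tendsto ψ (nhds 0) (nhds (extChartAt 𝓘(ℂ, E) p p)) :=
    hψ0 ▸ hψ.continuous.continuousAt (x := 0)
  have hφ : ContDiffAt ℝ 2 (h.localPotential p) (extChartAt 𝓘(ℂ, E) p p) :=
    (h.contDiffAt_localPotential p).of_le (by norm_cast)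
  have hev : ∀ᶠ y in nhds 0, ∀ a b, coeffs 𝓘(ℂ, E) gM z.symm y a b =
      ddbar (fun z => (h.localPotential p z : ℂ)) (ψ y) (fderiv ℂ ψ y a) (fderiv ℂ ψ y b) := by
    filter_upwards [htend.eventually (h.eventually_coeffs_base hcurv p),
      htend.eventually (extChartAt_target_mem_nhds (I := 𝓘(ℂ, E)) p)] with y h1 h2 a b
    rw [hzsymm, coeffs_comp gM ((contMDiffAt_extChartAt_symm h2).mdifferentiableAt (by simp))
      (hψ.differentiable (by simp)).differentiableAt, h1]
  have hw : ∀ a b c, wirtinger (fun y => coeffs 𝓘(ℂ, E) gM z.symm y a b) (z p) c = 0 :=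
    fun a b c => by
      rw [hzp, Filter.EventuallyEq.wirtinger_eq (hev.mono fun y hy => hy a b)]
      exact hgeo a b c
  refine ⟨?_, ?_, fun a b => ?_, fun a b c => ⟨hw a b c, ?_⟩⟩
  · refine isHolomorphicChart_extChartHomeo_trans p hκ (hψ.contDiffOn.congr fun y _ => hκψ y)
  · rw [hz, OpenPartialHomeomorph.trans_source, extChartHomeo_source]
    refine ⟨mem_extChartAt_source p, ?_⟩
    rw [Set.mem_preimage, extChartHomeo_apply, ← hψ0]
    exact hκ0
  · rw [hzp, hev.self_of_nhds, hψ0, hunit]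
  -- Hermitian symmetry reduces the `(0,1)`-derivatives to the `(1,0)`-derivatives with the
  -- arguments exchanged.
  · have hconj : (fun y => coeffs 𝓘(ℂ, E) gM z.symm y a b) =ᶠ[nhds (z p)]
        fun y => (starRingEnd ℂ) (coeffs 𝓘(ℂ, E) gM z.symm y b a) := by
      rw [hzp]
      filter_upwards [hev, htend.eventually (hφ.eventually (by norm_num))] with y h1 h2
      rw [h1, h1, conj_ddbar_ofReal h2.ofReal]
    rw [hconj.wirtingerBar_eq, wirtingerBar_conj, hw, map_zero]

end Base

theorem HermitianLineMetric.exists_adapted_coordinates [FiniteDimensional ℂ E]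
    (h : HermitianLineMetric 𝓘(ℂ, E) L) {gM : FormField 𝓘(ℂ, E) M}
    (hgM : IsKahlerOn 𝓘(ℂ, E) gM Set.univ)
    (hcurv : ∀ (p : M) (U V : TangentSpace 𝓘(ℂ, E) p), gM p U V = h.curvatureForm p U V)
    {m : ℕ} (hm : Module.finrank ℂ E = m) {η₀ : DualTotal L} (hη₀ : η₀ ∈ h.discBundle) :
    ∃ (z : OpenPartialHomeomorph M (EuclideanSpace ℂ (Fin m))) (s : ∀ x, L x)
      (Φ : OpenPartialHomeomorph (DualTotal L) (EuclideanSpace ℂ (Fin m) × ℂ)),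
      IsGeodesicAt 𝓘(ℂ, E) gM z η₀.1 ∧
      ContMDiffOn 𝓘(ℂ, E) (𝓘(ℂ, E).prod 𝓘(ℂ, ℂ)) ω
        (fun x => TotalSpace.mk' ℂ x (s x)) z.source ∧
      h.normSq (s η₀.1) = 1 ∧
      IsHolomorphicChart (dualModel 𝓘(ℂ, E)) Φ ∧
      Φ.source = {η | η.1 ∈ z.source} ∧
      (∀ η ∈ Φ.source, Φ η = (z η.1, η.2 (s η.1))) ∧
      (∀ (a b : EuclideanSpace ℂ (Fin m)) (α β : ℂ),
        coeffs (dualModel 𝓘(ℂ, E)) (h.discMetric gM) Φ.symm (Φ η₀) (a, α) (b, β) =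
          (1 / (1 - ‖(Φ η₀).2‖ ^ 2) : ℝ) *
            ((1 / (1 - ‖(Φ η₀).2‖ ^ 2) : ℝ) * (α * (starRingEnd ℂ) β) +
              ∑ j, a j * (starRingEnd ℂ) (b j))) ∧
      ‖(Φ η₀).2‖ ^ 2 = h.dualNormSq η₀ := by
  set p := η₀.1 with hp
  set x := extChartAt 𝓘(ℂ, E) p p with hx
  set φ := h.localPotential p with hφdef
  have hpb : p ∈ (trivializationAt ℂ L p).baseSet := FiberBundle.mem_baseSet_trivializationAt' p
  have hφ : ContDiffAt ℝ 4 φ x := (h.contDiffAt_localPotential p).of_le (by norm_cast)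
  obtain ⟨ψ, A, hψ, hψ0, hψA, hunit, hgeo⟩ := exists_geodesic_param hm hφ
    (h.isHermitianInner_localPotential hgM hcurv p)
  have hS : {z | z ∈ (extChartAt 𝓘(ℂ, E) p).target ∧
      (extChartAt 𝓘(ℂ, E) p).symm z ∈ (trivializationAt ℂ L p).baseSet} ∈ nhds (ψ 0) := by
    rw [hψ0]
    refine Filter.inter_mem (extChartAt_target_mem_nhds p)
      ((continuousAt_extChartAt_symm p).preimage_mem_nhds
        ((trivializationAt ℂ L p).open_baseSet.mem_nhds ?_))
    rwa [extChartAt_to_inv]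
  obtain ⟨κ, hκψ, hκ0, hκ00, hκS, hκ⟩ := exists_openPartialHomeomorph_symm_eq hψ hψA hS
  have hκsymm : ContDiffOn ℂ ω κ.symm κ.target := hψ.contDiffOn.congr fun y _ => hκψ y
  -- The differential `∂φ` at the point in the new coordinates. For the frame multiplied by `f = exp
  -- (φ(x)/2 + ℓ)` the potential is `φ - φ(x) - 2 Re ℓ`, which vanishes to first order at the point.
  let ℓ : EuclideanSpace ℂ (Fin m) →L[ℂ] ℂ := LinearMap.toContinuousLinearMap
    { toFun := fun a => wirtinger (fun z => (φ z : ℂ)) x (A a)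
      map_add' := fun a b => by rw [map_add, wirtinger_add_right]
      map_smul' := fun c a => by rw [map_smul, wirtinger_smul_right]; rfl }
  have hℓ : ∀ a, ℓ a = wirtinger (fun z => (φ z : ℂ)) x (A a) := fun a => rfl
  let f : EuclideanSpace ℂ (Fin m) → ℂ := fun y => Complex.exp ((φ x / 2 : ℝ) + ℓ y)
  have hf : ContDiff ℂ ω f := (contDiff_const.add ℓ.contDiff).cexp
  have hf0 : ∀ y, f y ≠ 0 := fun y => Complex.exp_ne_zero _
  have hfz : f 0 = (Real.exp (φ x / 2) : ℂ) := by simp [f]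
  have hfd : ∀ a, fderiv ℂ f 0 a = f 0 * ℓ a := fun a => by
    have h1 : HasFDerivAt f _ 0 := ((ℓ.hasFDerivAt (x := 0)).const_add ((φ x / 2 : ℝ) : ℂ)).cexp
    rw [h1.fderiv]
    simp [f]
  have hexp : Real.exp (φ x / 2) ^ 2 = Real.exp (φ x) := by
    rw [← Real.exp_nat_mul]; congr 1; push_cast; ring
  set z := (extChartHomeo 𝓘(ℂ, E) p).trans κ with hz
  have hzsrc : ∀ q, q ∈ z.source ↔ q ∈ (extChartAt 𝓘(ℂ, E) p).source ∧
      extChartAt 𝓘(ℂ, E) p q ∈ κ.source := fun q => by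
    rw [hz, OpenPartialHomeomorph.trans_source, extChartHomeo_source]; rfl
  have hzb : ∀ q ∈ z.source, q ∈ (trivializationAt ℂ L p).baseSet := fun q hq => by
    have h1 := (hκS ((hzsrc q).1 hq).2).2
    rwa [(extChartAt 𝓘(ℂ, E) p).left_inv ((hzsrc q).1 hq).1] at h1
  have hgeod : IsGeodesicAt 𝓘(ℂ, E) gM z p :=
    h.isGeodesicAt hcurv hψ hψ0 (fun a b => by rw [hψA.fderiv]; exact hunit a b) hgeo hκψ hκ0 hκ00 hκ
  have hzp : z p = 0 := by
    rw [hz, OpenPartialHomeomorph.trans_apply, extChartHomeo_apply, ← hx, ← hψ0, hκ00]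
  let s : ∀ q, L q := fun q => f (z q) • localFrame L p q
  let Ψ := lineCoordinates κ f hf.continuous hf0
  let Φ := (extChartHomeo (dualModel 𝓘(ℂ, E)) η₀).trans Ψ
  have hnorm : h.normSq (s p) = 1 := by
    have h1 : φ x = -Real.log (h.normSq (localFrame L p p)) := by
      rw [hφdef, HermitianLineMetric.localPotential, hx, extChartAt_to_inv]
    have h2 := h.normSq_localFrame_pos hpb
    simp only [s]
    rw [h.normSq_smul, hzp, hfz, Complex.norm_real, Real.norm_eq_abs, sq_abs, hexp, h1,
      Real.exp_neg, Real.exp_log h2, inv_mul_cancel₀ h2.ne']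
  have hΦsrc : Φ.source = {η | η.1 ∈ z.source} := by
    ext η
    have h1 : η ∈ (extChartAt (dualModel 𝓘(ℂ, E)) η₀).source ↔
        η.1 ∈ (extChartAt 𝓘(ℂ, E) p).source ∧ η.1 ∈ (trivializationAt ℂ L p).baseSet := by
      rw [extChartAt_source, FiberBundle.chartedSpace_chartAt, extChartAt_source]
      simp only [hp, mfld_simps, Bundle.Trivial.fiberBundle_trivializationAt',
        Bundle.Trivial.trivialization_baseSet, Set.inter_univ]
      exact and_comm
    simp only [Φ, OpenPartialHomeomorph.trans_source, extChartHomeo_source, Set.mem_inter_iff,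
      Set.mem_preimage, Set.mem_ofPred_eq, h1, hzsrc, extChartHomeo_apply]
    have h2 : extChartAt (dualModel 𝓘(ℂ, E)) η₀ η ∈ Ψ.source ↔
        extChartAt 𝓘(ℂ, E) p η.1 ∈ κ.source := by
      rw [← extChartAt_dual_fst η₀ η]
      exact ⟨fun hh => hh.1, fun hh => ⟨hh, trivial⟩⟩
    rw [h2]
    exact ⟨fun hh => ⟨hh.1.1, hh.2⟩, fun hh => ⟨⟨hh.1, hzb _ ((hzsrc _).2 hh)⟩, hh.2⟩⟩
  have hΦ : ∀ η ∈ Φ.source, Φ η = (z η.1, η.2 (s η.1)) := fun η hη => by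
    have hη' : η.1 ∈ z.source := by rw [hΦsrc] at hη; exact hη
    have h1 : κ (extChartAt (dualModel 𝓘(ℂ, E)) η₀ η).1 = z η.1 := by
      rw [extChartAt_dual_fst]; rfl
    refine Prod.ext h1 ?_
    change f (κ (extChartAt (dualModel 𝓘(ℂ, E)) η₀ η).1) *
      fiberCoord E (extChartAt (dualModel 𝓘(ℂ, E)) η₀ η) = _
    rw [h1, fiberCoord_extChartAt η₀ η (hzb _ hη')]
    exact (map_smul η.2 (f (z η.1)) (localFrame L p η.1)).symm
  have hη₀Φ : η₀ ∈ Φ.source := by rw [hΦsrc]; exact hgeod.mem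
  have hΦη : Φ η₀ = (0, η₀.2 (s p)) := by rw [hΦ η₀ hη₀Φ, ← hzp]
  have hdual : ‖(Φ η₀).2‖ ^ 2 = h.dualNormSq η₀ := by
    have hs0 : s p ≠ 0 := fun h0 => by
      have := h.normSq_smul (0 : ℂ) (s p)
      rw [zero_smul, ← h0, hnorm] at this
      simp at this
    rw [h.dualNormSq_eq η₀ hs0, hnorm, div_one, hΦη]
  refine ⟨z, s, Φ, hgeod, ?_, hnorm, ?_, hΦsrc, hΦ, fun a b α β => ?_, hdual⟩
  · refine ContMDiffOn.smul_section ?_ ((contMDiffOn_localFrame p).mono hzb)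
    exact hf.contMDiff.comp_contMDiffOn hgeod.chart.holo
  · exact isHolomorphicChart_extChartHomeo_trans η₀ (contDiffOn_lineCoordinates hκ hf hf0)
      (contDiffOn_lineCoordinates_symm hκsymm hf hf0)
  · set w₀ := extChartAt (dualModel 𝓘(ℂ, E)) η₀ η₀ with hw₀
    have hΨw : Ψ w₀ = (0, η₀.2 (s p)) := hΦη
    have hw₀s : w₀ ∈ Ψ.source := by
      have h1 := hη₀Φ
      simp only [Φ, OpenPartialHomeomorph.trans_source] at h1
      exact h1.2
    have hΨs : Ψ.symm (0, η₀.2 (s p)) = w₀ := by rw [← hΨw, Ψ.left_inv hw₀s]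
    have hw₀1 : w₀.1 = x := extChartAt_dual_self_fst η₀
    have hκA : HasFDerivAt κ.symm (A : EuclideanSpace ℂ (Fin m) →L[ℂ] E) 0 := by
      rw [show (κ.symm : EuclideanSpace ℂ (Fin m) → E) = ψ from funext hκψ]
      exact hψA
    have hderiv := fderiv_lineCoordinates_symm hf hf0 (v := η₀.2 (s p)) hκA
    have hφ2 : ContDiffAt ℝ 2 (fun z => (φ z : ℂ)) w₀.1 := by
      rw [hw₀1]; exact (hφ.of_le (by norm_num)).ofReal
    have hτ : discDefect (fiberCoord E) (fun z => φ z.1) w₀ = 1 - ‖(Φ η₀).2‖ ^ 2 := by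
      rw [hdual]; exact h.discDefect_self η₀
    have hτ0 : 0 < discDefect (fiberCoord E) (fun z => φ z.1) w₀ := by
      rw [hτ, hdual]; exact sub_pos.2 hη₀
    have hfib : fiberCoord E w₀ = η₀.2 (s p) / f 0 := by
      rw [← hΨs]
      change ((η₀.2 (s p) / f 0) • ContinuousLinearMap.id ℂ ℂ) 1 = _
      simp
    -- The fibre coordinate of the old frame is `v / f`. Its differential contributes `-v ℓ / f`,
    -- which cancels the term `(v / f) ∂φ` of the connection form.
    have hconn : ∀ (a : EuclideanSpace ℂ (Fin m)) (α : ℂ),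
        connForm (fiberCoord E) (fun z => φ z.1) w₀ (fderiv ℂ Ψ.symm (0, η₀.2 (s p)) (a, α))
          = α / f 0 := fun a α => by
      have h0 := hf0 0
      obtain ⟨-, h1, h2⟩ := hderiv a α
      rw [connForm, wirtinger_comp_fst (F := fun z => (φ z : ℂ))
        (hφ2.differentiableAt (by norm_num)), h1, h2, hfd, hℓ, hfib, hw₀1]
      change _ + _ * wirtinger _ x (A a) = _
      field_simp
      ring
    have hbase : ∀ (a b : EuclideanSpace ℂ (Fin m)) (α β : ℂ),
        ddbar (fun z : E × (ℂ →L[ℂ] ℂ) => (φ z.1 : ℂ)) w₀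
          (fderiv ℂ Ψ.symm (0, η₀.2 (s p)) (a, α)) (fderiv ℂ Ψ.symm (0, η₀.2 (s p)) (b, β))
          = ∑ j, a j * (starRingEnd ℂ) (b j) := fun a b α β => by
      rw [ddbar_comp_fst (F := fun z => (φ z : ℂ)) hφ2, (hderiv a α).2.1, (hderiv b β).2.1, hw₀1]
      exact hunit a b
    have hcoeff : coeffs (dualModel 𝓘(ℂ, E)) (h.discMetric gM) Φ.symm (Φ η₀) (a, α) (b, β) =
        ddbar (fun z => (discPotential (fiberCoord E) (fun z => φ z.1) z : ℂ)) w₀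
          (fderiv ℂ Ψ.symm (0, η₀.2 (s p)) (a, α))
          (fderiv ℂ Ψ.symm (0, η₀.2 (s p)) (b, β)) := by
      have h1 := coeffs_comp (h.discMetric gM) (ψ := (extChartAt (dualModel 𝓘(ℂ, E)) η₀).symm)
        (τ := Ψ.symm) (y := (0, η₀.2 (s p))) (by
          rw [hΨs]
          exact (contMDiffAt_extChartAt_symm (mem_extChartAt_target η₀)).mdifferentiableAt
            (by simp)) (hderiv 0 0).1 (a, α) (b, β)
      rw [hΨs, (h.eventually_coeffs_discMetric hcurv hη₀).self_of_nhds] at h1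
      rw [hΦη]
      exact h1
    -- The weight `e^φ` cancels the two factors `1 / f(0)` of the connection form; `f(0)` is real.
    have hexpC : (Real.exp (φ w₀.1) : ℂ) = f 0 * f 0 := by
      rw [hw₀1, hfz, ← hexp]; push_cast; ring
    have hconj : (starRingEnd ℂ) (f 0) = f 0 := by rw [hfz, Complex.conj_ofReal]
    rw [hcoeff, ddbar_discPotential (contDiffAt_comp_fst (f := fun z => (φ z : ℂ)) hφ2) hτ0,
      hbase, hconn, hconn, hexpC, map_div₀, hconj, hτ]
    rw [hτ] at hτ0
    have h0 := hf0 0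
    have h1 : ((1 - ‖(Φ η₀).2‖ ^ 2 : ℝ) : ℂ) ≠ 0 := by exact_mod_cast hτ0.ne'
    generalize (1 - ‖(Φ η₀).2‖ ^ 2 : ℝ) = t at h1 ⊢
    push_cast
    field_simp
    ring

end AdaptedCoordinates

theorem mainTheorem3 {m : ℕ}
    {M : Type*} [TopologicalSpace M] [ChartedSpace (EuclideanSpace ℂ (Fin m)) M]
    [IsManifold 𝓘(ℂ, EuclideanSpace ℂ (Fin m)) ω M]
    (L : M → Type*) [∀ x, AddCommGroup (L x)] [∀ x, Module ℂ (L x)] [∀ x, TopologicalSpace (L x)]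
    [TopologicalSpace (TotalSpace ℂ L)] [FiberBundle ℂ L] [VectorBundle ℂ ℂ L]
    [ContMDiffVectorBundle ω ℂ L 𝓘(ℂ, EuclideanSpace ℂ (Fin m))]
    (h : HermitianLineMetric 𝓘(ℂ, EuclideanSpace ℂ (Fin m)) L)
    (gM : FormField 𝓘(ℂ, EuclideanSpace ℂ (Fin m)) M)
    (hgM : IsKahlerOn 𝓘(ℂ, EuclideanSpace ℂ (Fin m)) gM Set.univ)
    (hcurv : ∀ (p : M) (U V : TangentSpace 𝓘(ℂ, EuclideanSpace ℂ (Fin m)) p),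
      gM p U V = h.curvatureForm p U V) :
    IsKahlerOn (dualModel 𝓘(ℂ, EuclideanSpace ℂ (Fin m))) (h.discMetric gM) h.discBundle ∧
    ∀ η₀ ∈ h.discBundle,
      -- adapted coordinates `(z, v)`: geodesic coordinates `z` on the base, and the fibre
      -- coordinate `v` with respect to a holomorphic frame `s` of `L`
      ∃ (z : OpenPartialHomeomorph M (EuclideanSpace ℂ (Fin m))) (s : ∀ x, L x)
        (Φ : OpenPartialHomeomorph (DualTotal L) (EuclideanSpace ℂ (Fin m) × ℂ)),
        IsGeodesicAt 𝓘(ℂ, EuclideanSpace ℂ (Fin m)) gM z η₀.1 ∧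
        ContMDiffOn 𝓘(ℂ, EuclideanSpace ℂ (Fin m))
          (𝓘(ℂ, EuclideanSpace ℂ (Fin m)).prod 𝓘(ℂ, ℂ)) ω
          (fun x => TotalSpace.mk' ℂ x (s x)) z.source ∧
        h.normSq (s η₀.1) = 1 ∧
        IsHolomorphicChart (dualModel 𝓘(ℂ, EuclideanSpace ℂ (Fin m))) Φ ∧
        Φ.source = {η | η.1 ∈ z.source} ∧
        (∀ η ∈ Φ.source, Φ η = (z η.1, η.2 (s η.1))) ∧
        -- `g_D(η₀) = (dv dv̄ / (1 - |v|²) + ∑ dz_j dz̄_j) / (1 - |v|²)`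
        (∀ (a b : EuclideanSpace ℂ (Fin m)) (α β : ℂ),
          coeffs (dualModel 𝓘(ℂ, EuclideanSpace ℂ (Fin m))) (h.discMetric gM) Φ.symm (Φ η₀)
              (a, α) (b, β) =
            (1 / (1 - ‖(Φ η₀).2‖ ^ 2) : ℝ) *
              ((1 / (1 - ‖(Φ η₀).2‖ ^ 2) : ℝ) * (α * (starRingEnd ℂ) β) +
                ∑ j, a j * (starRingEnd ℂ) (b j))) ∧
        -- the curvature formula; `|v|²` is the squared norm of `η₀`
        ‖(Φ η₀).2‖ ^ 2 = h.dualNormSq η₀ ∧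
        ∀ U : TangentSpace (dualModel 𝓘(ℂ, EuclideanSpace ℂ (Fin m))) η₀, U ≠ 0 →
          holSectCurv (dualModel 𝓘(ℂ, EuclideanSpace ℂ (Fin m))) (h.discMetric gM) η₀ U =
            -2 * ((h.discMetric gM η₀ U U).re ^ 2 -
                (gM η₀.1 (dualProjDeriv η₀ U) (dualProjDeriv η₀ U)).re ^ 2 /
                    (1 - ‖(Φ η₀).2‖ ^ 2) *
                  (1 + 1 / 2 * holSectCurv 𝓘(ℂ, EuclideanSpace ℂ (Fin m)) gM η₀.1
                    (dualProjDeriv η₀ U))) /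
              (h.discMetric gM η₀ U U).re ^ 2 := by
  refine ⟨h.isKahlerOn_discMetric hgM hcurv, fun η₀ hη₀ => ?_⟩
  obtain ⟨z, s, Φ, h1, h2, h3, h4, h5, h6, h7, h8⟩ :=
    h.exists_adapted_coordinates hgM hcurv (m := m) finrank_euclideanSpace_fin hη₀
  refine ⟨z, s, Φ, h1, h2, h3, h4, h5, h6, h7, h8, fun U hU => ?_⟩
  rw [h8]
  exact h.holSectCurv_discMetric hgM hcurv hη₀ hU
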